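/- **Conventions.** A premodel category is a complete and cocomplete category $\mathcal C$ with two weak factorization systems (cofibrations, anodyne fibrations) and (anodyne cofibrations, fibrations) such that every anodyne cofibration is a cofibration. An object is cofibrant (fibrant) if the map from the initial object (to the terminal object) is a cofibration (fibration). An acyclic cofibration is a cofibration with the left lifting property against all fibrations between fibrant objects; an acyclic fibration is a fibration with the right lifting property against all cofibrations between cofibrant objects. An acyclic cofibration with cofibrant domain, or an acyclic fibration with fibrant target, is called core. $\mathcal C$ is a weak model category if, for every cofibration $A\to X$ from a cofibrant object to a fibrant object, the codiagonal factors as $X\coprod_A X\to I\to X$, where the first map is a cofibration and its first leg $X\to I$ is an acyclic cofibration, and, dually, for every fibration $A\to X$ from a cofibrant object to a fibrant object, the diagonal factors as $A\to P\to A\times_X A$, where the second map is a fibration and its first component $P\to A$ is an acyclic fibration. In that case $Ho(\mathcal C)$ denotes the localization of the full subcategory $\mathcal C^{c\vee f}$ of objects that are fibrant or cofibrant at the core acyclic cofibrations and the core acyclic fibrations, and an equivalence of $\mathcal C$ is a map of $\mathcal C^{c\vee f}$ that becomes invertible in $Ho(\mathcal C)$. $\mathcal C$ is a two-sided semi-model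 category if (a) it is a weak model category; (b) every cofibrant $X$ has a strong cylinder object (a factorization $X\coprod X\to IX\to X$ of the codiagonal whose first map is a cofibration with acyclic first leg $X\to IX$), and every fibrant $X$ has a strong path object (a factorization $X\to PX\to X\times X$ of the diagonal whose second map is a fibration with acyclic first component $PX\to X$); (c) every acyclic cofibration is anodyne and every acyclic fibration is anodyne. A class $\mathcal W$ makes $\mathcal C$ a left semi-model category if: $\mathcal W$ satisfies 2-out-of-3; $\mathcal W$, the cofibrations and the fibrations are stable under retracts; every map with cofibrant domain factors as a cofibration followed by a fibration in $\mathcal W$ and as a cofibration in $\mathcal W$ followed by a fibration; every cofibration $i$ with cofibrant domain lifts on the left against every fibration $p$ as soon as $i$ or $p$ is in $\mathcal W$; fibrations are stable under pullback; the initial object is cofibrant; and (cofibrations, fibrations in $\mathcal W$) is a weak factorization system. Right semi-model categories are defined dually. **Proposition.** Let $\mathcal C$ be a two-sided semi-model category. There is a unique class $\mathcal W_L$ (the left equivalences) making $\mathcal C$ a left semi-model category and a unique class $\mathcal W_R$ (the right equivalences) making it a right semi-model category. The left localization functor $\mathcal C\to Ho(\mathcal C)$ sends an object to a cofibrant replacement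 (given by an anodyne fibration $X^{cof}\to X$ with $X^{cof}$ cofibrant) and a map to a lift to the cofibrant replacements; the right localization functor dually uses fibrant replacements (given by an anodyne cofibration $X\to X^{fib}$ with $X^{fib}$ fibrant). The following conditions are all equivalent: 1. $\mathcal W_R=\mathcal W_L$. 2. $\mathcal W_L$, together with the cofibrations and fibrations of $\mathcal C$, is a Quillen model structure. 2'. $\mathcal W_R$, together with the cofibrations and fibrations of $\mathcal C$, is a Quillen model structure. 3. Every anodyne cofibration is in $\mathcal W_L$. 3'. Every anodyne fibration is in $\mathcal W_R$. 4. For every arrow $v\colon X\to Y$ there is a commutative square formed by $v$, an arrow $X'\to Y'$ between fibrant objects, and maps $X\to X'$ and $Y\to Y'$ in $\mathcal W_L$. 4'. For every arrow $v\colon X\to Y$ there is a commutative square formed by $v$, an arrow $X'\to Y'$ between cofibrant objects, and maps $X'\to X$ and $Y'\to Y$ in $\mathcal W_R$. 5. For every object $X$ there are a cofibrant replacement $X^{cof}\to X$ and a fibrant replacement $X\to X^{fib}$ whose composite $X^{cof}\to X\to X^{fib}$ is an equivalence of $\mathcal C$. 6. The left and right localization functors $\mathcal C\rightrightarrows Ho(\mathcal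 C)$ are isomorphic. In particular, if every object of $\mathcal C$ is fibrant or cofibrant, then all these conditions hold. -/

import Mathlib

open CategoryTheory CategoryTheory.Limits

universe v u

/-- A premodel structure on a complete and cocomplete category: two weak factorization systems
(cofibrations, anodyne fibrations) and (anodyne cofibrations, fibrations) such that every anodyne
cofibration is a cofibration. -/
structure PremodelStructure (C : Type u) [Category.{v} C] [HasLimits C] [HasColimits C] where
  cof : MorphismProperty C
  anoFib : MorphismProperty C
  anoCof : MorphismProperty C
  fib : MorphismProperty C
  wfs_cof_anoFib : MorphismProperty.IsWeakFactorizationSystem cof anoFib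
  wfs_anoCof_fib : MorphismProperty.IsWeakFactorizationSystem anoCof fib
  anoCof_le_cof : anoCof ≤ cof

namespace PremodelStructure

section

variable {C : Type u} [Category.{v} C] [HasLimits C] [HasColimits C] (P : PremodelStructure C)

/-- An object is cofibrant if the map from the initial object is a cofibration. -/
def IsCofibrant (X : C) : Prop := P.cof (initial.to X)

/-- An object is fibrant if the map to the terminal object is a fibration. -/
def IsFibrant (X : C) : Prop := P.fib (terminal.from X)

/-- Acyclic cofibrations: cofibrations with the left lifting property against all fibrations
between fibrant objects. -/
def acyclicCof : MorphismProperty C := fun _ _ i =>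
  P.cof i ∧ ∀ ⦃X Y : C⦄ (p : X ⟶ Y), P.IsFibrant X → P.IsFibrant Y → P.fib p →
    HasLiftingProperty i p

/-- Acyclic fibrations: fibrations with the right lifting property against all cofibrations
between cofibrant objects. -/
def acyclicFib : MorphismProperty C := fun _ _ p =>
  P.fib p ∧ ∀ ⦃A B : C⦄ (i : A ⟶ B), P.IsCofibrant A → P.IsCofibrant B → P.cof i →
    HasLiftingProperty i p

/-- Every cofibration from a cofibrant object to a fibrant object has a relative strong cylinder
object: a factorization of the codiagonal as a cofibration followed by a map, such that the
first leg is an acyclic cofibration. -/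
def CylinderAxiom : Prop :=
  ∀ ⦃A X : C⦄ (i : A ⟶ X), P.IsCofibrant A → P.IsFibrant X → P.cof i →
    ∃ (I : C) (j : pushout i i ⟶ I) (s : I ⟶ X),
      j ≫ s = pushout.desc (𝟙 X) (𝟙 X) rfl ∧ P.cof j ∧ P.acyclicCof (pushout.inl i i ≫ j)

/-- Every fibration from a cofibrant object to a fibrant object has a relative strong path
object. -/
def PathObjectAxiom : Prop :=
  ∀ ⦃A X : C⦄ (p : A ⟶ X), P.IsCofibrant A → P.IsFibrant X → P.fib p →
    ∃ (E : C) (s : A ⟶ E) (q : E ⟶ pullback p p),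
      s ≫ q = pullback.lift (𝟙 A) (𝟙 A) rfl ∧ P.fib q ∧ P.acyclicFib (q ≫ pullback.fst p p)

/-- A premodel category which is a weak model category. -/
structure IsWeakModel : Prop where
  cylinder : P.CylinderAxiom
  path : P.PathObjectAxiom

/-- Every cofibrant object has a strong cylinder object `X ⨿ X ↪ I → X`. -/
def HasStrongCylinders : Prop :=
  ∀ ⦃X : C⦄, P.IsCofibrant X →
    ∃ (I : C) (j : X ⨿ X ⟶ I) (s : I ⟶ X),
      j ≫ s = coprod.desc (𝟙 X) (𝟙 X) ∧ P.cof j ∧ P.acyclicCof (coprod.inl ≫ j)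

/-- Every fibrant object has a strong path object `X → E ↠ X ⨯ X`. -/
def HasStrongPathObjects : Prop :=
  ∀ ⦃X : C⦄, P.IsFibrant X →
    ∃ (E : C) (s : X ⟶ E) (q : E ⟶ X ⨯ X),
      s ≫ q = prod.lift (𝟙 X) (𝟙 X) ∧ P.fib q ∧ P.acyclicFib (q ≫ prod.fst)

/-- Left and right saturation. -/
structure IsBisaturated : Prop where
  left : P.acyclicCof ≤ P.anoCof
  right : P.acyclicFib ≤ P.anoFib

/-- Two-sided semi-model categories. -/
structure IsTwoSided : Prop where
  weakModel : P.IsWeakModel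
  strongPathObjects : P.HasStrongPathObjects
  strongCylinders : P.HasStrongCylinders
  bisaturated : P.IsBisaturated

/-- `W` makes the category, with the cofibrations and fibrations of `P`, into a (Spitzweck) left
semi-model category. -/
structure IsLeftSemiModel (W : MorphismProperty C) : Prop where
  twoOutOfThree : W.HasTwoOutOfThreeProperty
  retract_W : W.IsStableUnderRetracts
  retract_cof : P.cof.IsStableUnderRetracts
  retract_fib : P.fib.IsStableUnderRetracts
  fac_cof_trivFib : ∀ ⦃X Y : C⦄ (f : X ⟶ Y), P.IsCofibrant X →
    ∃ (Z : C) (i : X ⟶ Z) (p : Z ⟶ Y), i ≫ p = f ∧ P.cof i ∧ P.fib p ∧ W p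
  fac_trivCof_fib : ∀ ⦃X Y : C⦄ (f : X ⟶ Y), P.IsCofibrant X →
    ∃ (Z : C) (i : X ⟶ Z) (p : Z ⟶ Y), i ≫ p = f ∧ P.cof i ∧ W i ∧ P.fib p
  lift : ∀ ⦃A B X Y : C⦄ (i : A ⟶ B) (p : X ⟶ Y), P.IsCofibrant A → P.cof i → P.fib p →
    (W i ∨ W p) → HasLiftingProperty i p
  fib_baseChange : P.fib.IsStableUnderBaseChange
  initial_cofibrant : P.IsCofibrant (⊥_ C)
  wfs : MorphismProperty.IsWeakFactorizationSystem P.cof (P.fib ⊓ W)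

/-- `W` makes the category, with the cofibrations and fibrations of `P`, into a (Spitzweck) right
semi-model category. -/
structure IsRightSemiModel (W : MorphismProperty C) : Prop where
  twoOutOfThree : W.HasTwoOutOfThreeProperty
  retract_W : W.IsStableUnderRetracts
  retract_cof : P.cof.IsStableUnderRetracts
  retract_fib : P.fib.IsStableUnderRetracts
  fac_trivCof_fib : ∀ ⦃X Y : C⦄ (f : X ⟶ Y), P.IsFibrant Y →
    ∃ (Z : C) (i : X ⟶ Z) (p : Z ⟶ Y), i ≫ p = f ∧ P.cof i ∧ W i ∧ P.fib p
  fac_cof_trivFib : ∀ ⦃X Y : C⦄ (f : X ⟶ Y), P.IsFibrant Y →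
    ∃ (Z : C) (i : X ⟶ Z) (p : Z ⟶ Y), i ≫ p = f ∧ P.cof i ∧ P.fib p ∧ W p
  lift : ∀ ⦃A B X Y : C⦄ (i : A ⟶ B) (p : X ⟶ Y), P.cof i → P.IsFibrant Y → P.fib p →
    (W i ∨ W p) → HasLiftingProperty i p
  cof_cobaseChange : P.cof.IsStableUnderCobaseChange
  terminal_fibrant : P.IsFibrant (⊤_ C)
  wfs : MorphismProperty.IsWeakFactorizationSystem (P.cof ⊓ W) P.fib

/-- `W`, with the cofibrations and fibrations of `P`, is a Quillen model structure. -/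
def IsQuillenModel (W : MorphismProperty C) : Prop :=
  ∃ M : HomotopicalAlgebra.ModelCategory C,
    M.categoryWithCofibrations.cofibrations = P.cof ∧
    M.categoryWithFibrations.fibrations = P.fib ∧
    M.categoryWithWeakEquivalences.weakEquivalences = W

/-- The objects that are fibrant or cofibrant. -/
def isFibrantOrCofibrant : ObjectProperty C := fun X => P.IsFibrant X ∨ P.IsCofibrant X

/-- The full subcategory of the objects that are fibrant or cofibrant. -/
abbrev CF := P.isFibrantOrCofibrant.FullSubcategory

/-- The core acyclic cofibrations and the core acyclic fibrations in `P.CF`. -/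
def coreAcyclic : MorphismProperty P.CF := fun X Y f =>
  (P.IsCofibrant X.obj ∧ P.acyclicCof f.hom) ∨ (P.IsFibrant Y.obj ∧ P.acyclicFib f.hom)

/-- The homotopy category, as the localization of the category of fibrant or cofibrant objects at
the core acyclic cofibrations and the core acyclic fibrations. -/
abbrev Ho := P.coreAcyclic.Localization

/-- The equivalences of the weak model category: the maps between objects that are fibrant or
cofibrant which become invertible in the homotopy category. -/
def equivalences : MorphismProperty P.CF := fun _ _ f => IsIso (P.coreAcyclic.Q.map f)

/-- A cofibrant object, as an object of `P.CF`. -/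
abbrev ofCofibrant (X : C) (h : P.IsCofibrant X) : P.CF := ⟨X, Or.inr h⟩

/-- A fibrant object, as an object of `P.CF`. -/
abbrev ofFibrant (X : C) (h : P.IsFibrant X) : P.CF := ⟨X, Or.inl h⟩

theorem exists_cofibrantReplacement (X : C) :
    ∃ (Z : C) (p : Z ⟶ X), P.IsCofibrant Z ∧ P.anoFib p := by
  obtain ⟨d⟩ := P.wfs_cof_anoFib.hasFactorization.nonempty_mapFactorizationData (initial.to X)
  have e : d.i = initial.to d.Z := Subsingleton.elim _ _
  exact ⟨d.Z, d.p, by rw [IsCofibrant, ← e]; exact d.hi, d.hp⟩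

theorem exists_fibrantReplacement (X : C) :
    ∃ (Z : C) (i : X ⟶ Z), P.IsFibrant Z ∧ P.anoCof i := by
  obtain ⟨d⟩ := P.wfs_anoCof_fib.hasFactorization.nonempty_mapFactorizationData (terminal.from X)
  have e : d.p = terminal.from d.Z := Subsingleton.elim _ _
  exact ⟨d.Z, d.i, by rw [IsFibrant, ← e]; exact d.hp, d.hi⟩

/-- A chosen cofibrant replacement of `X`. -/
noncomputable def cofRep (X : C) : C := (P.exists_cofibrantReplacement X).choose

/-- The anodyne fibration from the chosen cofibrant replacement of `X` to `X`. -/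
noncomputable def cofRepMap (X : C) : P.cofRep X ⟶ X :=
  (P.exists_cofibrantReplacement X).choose_spec.choose

theorem cofRep_isCofibrant (X : C) : P.IsCofibrant (P.cofRep X) :=
  (P.exists_cofibrantReplacement X).choose_spec.choose_spec.1

theorem cofRepMap_anoFib (X : C) : P.anoFib (P.cofRepMap X) :=
  (P.exists_cofibrantReplacement X).choose_spec.choose_spec.2

/-- A chosen fibrant replacement of `X`. -/
noncomputable def fibRep (X : C) : C := (P.exists_fibrantReplacement X).choose

/-- The anodyne cofibration from `X` to the chosen fibrant replacement of `X`. -/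
noncomputable def fibRepMap (X : C) : X ⟶ P.fibRep X :=
  (P.exists_fibrantReplacement X).choose_spec.choose

theorem fibRep_isFibrant (X : C) : P.IsFibrant (P.fibRep X) :=
  (P.exists_fibrantReplacement X).choose_spec.choose_spec.1

theorem fibRepMap_anoCof (X : C) : P.anoCof (P.fibRepMap X) :=
  (P.exists_fibrantReplacement X).choose_spec.choose_spec.2

theorem exists_lift_of_anoFib {A X Y : C} (hA : P.IsCofibrant A) (p : X ⟶ Y) (hp : P.anoFib p)
    (g : A ⟶ Y) : ∃ h : A ⟶ X, h ≫ p = g := by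
  have := P.wfs_cof_anoFib
  have := MorphismProperty.hasLiftingProperty_of_wfs _ _ hA hp
  have sq : CommSq (initial.to X) (initial.to A) p g := ⟨Subsingleton.elim _ _⟩
  exact ⟨sq.lift, sq.fac_right⟩

theorem exists_extension_of_anoCof {A B Y : C} (hY : P.IsFibrant Y) (i : A ⟶ B)
    (hi : P.anoCof i) (g : A ⟶ Y) : ∃ h : B ⟶ Y, i ≫ h = g := by
  have := P.wfs_anoCof_fib
  have := MorphismProperty.hasLiftingProperty_of_wfs _ _ hi hY
  have sq : CommSq g i (terminal.from Y) (terminal.from B) := ⟨Subsingleton.elim _ _⟩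
  exact ⟨sq.lift, sq.fac_left⟩

theorem isCofibrant_of_cof {A B : C} (hA : P.IsCofibrant A) (i : A ⟶ B) (hi : P.cof i) :
    P.IsCofibrant B := by
  have := P.wfs_cof_anoFib
  have e : initial.to B = initial.to A ≫ i := Subsingleton.elim _ _
  have hs : P.anoFib.llp (initial.to A ≫ i) := by
    apply MorphismProperty.comp_mem
    · rw [MorphismProperty.llp_eq_of_wfs P.cof P.anoFib]; exact hA
    · rw [MorphismProperty.llp_eq_of_wfs P.cof P.anoFib]; exact hi
  rw [MorphismProperty.llp_eq_of_wfs P.cof P.anoFib] at hs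
  rw [IsCofibrant, e]; exact hs

theorem isFibrant_of_fib {X Y : C} (hY : P.IsFibrant Y) (p : X ⟶ Y) (hp : P.fib p) :
    P.IsFibrant X := by
  have := P.wfs_anoCof_fib
  have e : terminal.from X = p ≫ terminal.from Y := Subsingleton.elim _ _
  have hs : P.anoCof.rlp (p ≫ terminal.from Y) := by
    apply MorphismProperty.comp_mem
    · rw [MorphismProperty.rlp_eq_of_wfs P.anoCof P.fib]; exact hp
    · rw [MorphismProperty.rlp_eq_of_wfs P.anoCof P.fib]; exact hY
  rw [MorphismProperty.rlp_eq_of_wfs P.anoCof P.fib] at hs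
  rw [IsFibrant, e]; exact hs

variable {P}

theorem Ho_map_eq_of_anoFib (hP : P.HasStrongCylinders) {A X Y : C} (hA : P.IsCofibrant A)
    (hX : P.IsCofibrant X) (p : X ⟶ Y) (hp : P.anoFib p) (f g : A ⟶ X) (h : f ≫ p = g ≫ p) :
    P.coreAcyclic.Q.map (ObjectProperty.homMk f : P.ofCofibrant A hA ⟶ P.ofCofibrant X hX) =
      P.coreAcyclic.Q.map (ObjectProperty.homMk g) := by
  obtain ⟨I, j, s, hjs, hj, hac⟩ := hP hA
  have hI : P.IsCofibrant I := P.isCofibrant_of_cof hA _ hac.1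
  have := P.wfs_cof_anoFib
  have := MorphismProperty.hasLiftingProperty_of_wfs _ _ hj hp
  have sq : CommSq (coprod.desc f g) j p (s ≫ f ≫ p) := ⟨by
    rw [← Category.assoc, hjs]
    ext <;> simp [h]⟩
  let i₀ : P.ofCofibrant A hA ⟶ P.ofCofibrant I hI := ObjectProperty.homMk (coprod.inl ≫ j)
  let i₁ : P.ofCofibrant A hA ⟶ P.ofCofibrant I hI := ObjectProperty.homMk (coprod.inr ≫ j)
  let σ : P.ofCofibrant I hI ⟶ P.ofCofibrant A hA := ObjectProperty.homMk s
  let k : P.ofCofibrant I hI ⟶ P.ofCofibrant X hX := ObjectProperty.homMk sq.lift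
  have e₀ : i₀ ≫ σ = 𝟙 _ := by
    apply ObjectProperty.hom_ext
    change (coprod.inl ≫ j) ≫ s = 𝟙 A
    rw [Category.assoc, hjs, coprod.inl_desc]
  have e₁ : i₁ ≫ σ = 𝟙 _ := by
    apply ObjectProperty.hom_ext
    change (coprod.inr ≫ j) ≫ s = 𝟙 A
    rw [Category.assoc, hjs, coprod.inr_desc]
  have hf : (ObjectProperty.homMk f : P.ofCofibrant A hA ⟶ P.ofCofibrant X hX) = i₀ ≫ k := by
    apply ObjectProperty.hom_ext
    change f = (coprod.inl ≫ j) ≫ sq.lift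
    rw [Category.assoc, sq.fac_left, coprod.inl_desc]
  have hg : (ObjectProperty.homMk g : P.ofCofibrant A hA ⟶ P.ofCofibrant X hX) = i₁ ≫ k := by
    apply ObjectProperty.hom_ext
    change g = (coprod.inr ≫ j) ≫ sq.lift
    rw [Category.assoc, sq.fac_left, coprod.inr_desc]
  have : IsIso (P.coreAcyclic.Q.map i₀) := P.coreAcyclic.Q_inverts i₀ (Or.inl ⟨hA, hac⟩)
  have e : P.coreAcyclic.Q.map i₀ = P.coreAcyclic.Q.map i₁ := by
    have hσ : IsIso (P.coreAcyclic.Q.map σ) := by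
      have hc : P.coreAcyclic.Q.map i₀ ≫ P.coreAcyclic.Q.map σ = 𝟙 _ := by
        rw [← Functor.map_comp, e₀, CategoryTheory.Functor.map_id]
      rw [← IsIso.inv_eq_of_hom_inv_id hc]; infer_instance
    rw [← cancel_mono (P.coreAcyclic.Q.map σ), ← Functor.map_comp, ← Functor.map_comp, e₀, e₁]
  rw [hf, hg, Functor.map_comp, Functor.map_comp, e]

theorem Ho_map_eq_of_anoCof (hP : P.HasStrongPathObjects) {A X Y : C} (hX : P.IsFibrant X)
    (hY : P.IsFibrant Y) (i : A ⟶ X) (hi : P.anoCof i) (f g : X ⟶ Y) (h : i ≫ f = i ≫ g) :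
    P.coreAcyclic.Q.map (ObjectProperty.homMk f : P.ofFibrant X hX ⟶ P.ofFibrant Y hY) =
      P.coreAcyclic.Q.map (ObjectProperty.homMk g) := by
  obtain ⟨E, s, q, hsq, hq, hac⟩ := hP hY
  have hE : P.IsFibrant E := P.isFibrant_of_fib hY _ hac.1
  have := P.wfs_anoCof_fib
  have := MorphismProperty.hasLiftingProperty_of_wfs _ _ hi hq
  have sq : CommSq (i ≫ f ≫ s) i q (prod.lift f g) := ⟨by
    rw [Category.assoc, Category.assoc, hsq]
    ext <;> simp [h]⟩
  let p₀ : P.ofFibrant E hE ⟶ P.ofFibrant Y hY := ObjectProperty.homMk (q ≫ prod.fst)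
  let p₁ : P.ofFibrant E hE ⟶ P.ofFibrant Y hY := ObjectProperty.homMk (q ≫ prod.snd)
  let σ : P.ofFibrant Y hY ⟶ P.ofFibrant E hE := ObjectProperty.homMk s
  let k : P.ofFibrant X hX ⟶ P.ofFibrant E hE := ObjectProperty.homMk sq.lift
  have e₀ : σ ≫ p₀ = 𝟙 _ := by
    apply ObjectProperty.hom_ext
    change s ≫ q ≫ prod.fst = 𝟙 Y
    rw [← Category.assoc, hsq, prod.lift_fst]
  have e₁ : σ ≫ p₁ = 𝟙 _ := by
    apply ObjectProperty.hom_ext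
    change s ≫ q ≫ prod.snd = 𝟙 Y
    rw [← Category.assoc, hsq, prod.lift_snd]
  have hf : (ObjectProperty.homMk f : P.ofFibrant X hX ⟶ P.ofFibrant Y hY) = k ≫ p₀ := by
    apply ObjectProperty.hom_ext
    change f = sq.lift ≫ q ≫ prod.fst
    rw [← Category.assoc, sq.fac_right, prod.lift_fst]
  have hg : (ObjectProperty.homMk g : P.ofFibrant X hX ⟶ P.ofFibrant Y hY) = k ≫ p₁ := by
    apply ObjectProperty.hom_ext
    change g = sq.lift ≫ q ≫ prod.snd
    rw [← Category.assoc, sq.fac_right, prod.lift_snd]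
  have : IsIso (P.coreAcyclic.Q.map p₀) := P.coreAcyclic.Q_inverts p₀ (Or.inr ⟨hY, hac⟩)
  have e : P.coreAcyclic.Q.map p₀ = P.coreAcyclic.Q.map p₁ := by
    have hσ : IsIso (P.coreAcyclic.Q.map σ) := by
      have hc : P.coreAcyclic.Q.map σ ≫ P.coreAcyclic.Q.map p₀ = 𝟙 _ := by
        rw [← Functor.map_comp, e₀, CategoryTheory.Functor.map_id]
      rw [← IsIso.inv_eq_of_inv_hom_id hc]; infer_instance
    rw [← cancel_epi (P.coreAcyclic.Q.map σ), ← Functor.map_comp, ← Functor.map_comp, e₀, e₁]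
  rw [hf, hg, Functor.map_comp, Functor.map_comp, e]

variable (P)

/-- A lift of `f` to the chosen cofibrant replacements. -/
noncomputable def cofRepLift {X Y : C} (f : X ⟶ Y) : P.cofRep X ⟶ P.cofRep Y :=
  (P.exists_lift_of_anoFib (P.cofRep_isCofibrant X) _ (P.cofRepMap_anoFib Y)
    (P.cofRepMap X ≫ f)).choose

theorem cofRepLift_comp {X Y : C} (f : X ⟶ Y) :
    P.cofRepLift f ≫ P.cofRepMap Y = P.cofRepMap X ≫ f :=
  (P.exists_lift_of_anoFib (P.cofRep_isCofibrant X) _ (P.cofRepMap_anoFib Y)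
    (P.cofRepMap X ≫ f)).choose_spec

/-- An extension of `f` to the chosen fibrant replacements. -/
noncomputable def fibRepExt {X Y : C} (f : X ⟶ Y) : P.fibRep X ⟶ P.fibRep Y :=
  (P.exists_extension_of_anoCof (P.fibRep_isFibrant Y) _ (P.fibRepMap_anoCof X)
    (f ≫ P.fibRepMap Y)).choose

theorem comp_fibRepExt {X Y : C} (f : X ⟶ Y) :
    P.fibRepMap X ≫ P.fibRepExt f = f ≫ P.fibRepMap Y :=
  (P.exists_extension_of_anoCof (P.fibRep_isFibrant Y) _ (P.fibRepMap_anoCof X)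
    (f ≫ P.fibRepMap Y)).choose_spec

variable {P}

/-- The left localization functor, sending each object to a cofibrant replacement. -/
noncomputable def leftLocalization (hP : P.HasStrongCylinders) : C ⥤ P.Ho where
  obj X := P.coreAcyclic.Q.obj (P.ofCofibrant (P.cofRep X) (P.cofRep_isCofibrant X))
  map f := P.coreAcyclic.Q.map (ObjectProperty.homMk (P.cofRepLift f))
  map_id X := by
    rw [← CategoryTheory.Functor.map_id]
    exact Ho_map_eq_of_anoFib hP _ _ _ (P.cofRepMap_anoFib X) _ (𝟙 _)
      (by simp [cofRepLift_comp])
  map_comp {X Y Z} f g := by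
    rw [← Functor.map_comp]
    exact Ho_map_eq_of_anoFib hP _ _ _ (P.cofRepMap_anoFib Z) _
      (P.cofRepLift f ≫ P.cofRepLift g)
      (by
        rw [Category.assoc, cofRepLift_comp, cofRepLift_comp, ← Category.assoc, ← Category.assoc,
          cofRepLift_comp])

/-- The right localization functor, sending each object to a fibrant replacement. -/
noncomputable def rightLocalization (hP : P.HasStrongPathObjects) : C ⥤ P.Ho where
  obj X := P.coreAcyclic.Q.obj (P.ofFibrant (P.fibRep X) (P.fibRep_isFibrant X))
  map f := P.coreAcyclic.Q.map (ObjectProperty.homMk (P.fibRepExt f))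
  map_id X := by
    rw [← CategoryTheory.Functor.map_id]
    exact Ho_map_eq_of_anoCof hP _ _ _ (P.fibRepMap_anoCof X) _ (𝟙 _)
      (by simp [comp_fibRepExt])
  map_comp {X Y Z} f g := by
    rw [← Functor.map_comp]
    exact Ho_map_eq_of_anoCof hP _ _ _ (P.fibRepMap_anoCof X) _
      (P.fibRepExt f ≫ P.fibRepExt g)
      (by
        rw [comp_fibRepExt, ← Category.assoc, comp_fibRepExt, Category.assoc, Category.assoc,
          comp_fibRepExt])

variable (P)

/-- Every arrow `v : X ⟶ Y` fits into a commutative square from `v` to an arrow between fibrant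
objects, whose two horizontal maps are in `W`. -/
def HasFibrantReplacements (W : MorphismProperty C) : Prop :=
  ∀ ⦃X Y : C⦄ (v : X ⟶ Y), ∃ (X' Y' : C) (a : X ⟶ X') (b : Y ⟶ Y') (v' : X' ⟶ Y'),
    P.IsFibrant X' ∧ P.IsFibrant Y' ∧ W a ∧ W b ∧ CommSq a v v' b

/-- Every arrow `v : X ⟶ Y` is the target of a commutative square from an arrow between cofibrant
objects, whose two horizontal maps are in `W`. -/
def HasCofibrantReplacements (W : MorphismProperty C) : Prop :=
  ∀ ⦃X Y : C⦄ (v : X ⟶ Y), ∃ (X' Y' : C) (a : X' ⟶ X) (b : Y' ⟶ Y) (v' : X' ⟶ Y'),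
    P.IsCofibrant X' ∧ P.IsCofibrant Y' ∧ W a ∧ W b ∧ CommSq a v' v b

/-- Every object has a cofibrant replacement `p` and a fibrant replacement `i` such that
`p ≫ i` is an equivalence of the weak model category. -/
def ReplacementsCompatible : Prop :=
  ∀ X : C, ∃ (Xc Xf : C) (hc : P.IsCofibrant Xc) (hf : P.IsFibrant Xf)
    (p : Xc ⟶ X) (i : X ⟶ Xf), P.anoFib p ∧ P.anoCof i ∧
      P.equivalences
        (ObjectProperty.homMk (p ≫ i) : P.ofCofibrant Xc hc ⟶ P.ofFibrant Xf hf)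

variable {P}

/-- The conditions of the characterization together with their duals, for given classes of left
equivalences `WL` and right equivalences `WR`. The conditions `WR = WL`, compatibility of the
replacements, and isomorphism of the localization functors are self-dual. -/
def quillenConditions (hP : P.IsTwoSided) (WL WR : MorphismProperty C) : List Prop :=
  [ WR = WL,
    P.IsQuillenModel WL,
    P.IsQuillenModel WR,
    P.anoCof ≤ WL,
    P.anoFib ≤ WR,
    P.HasFibrantReplacements WL,
    P.HasCofibrantReplacements WR,
    P.ReplacementsCompatible,
    Nonempty (leftLocalization hP.strongCylinders ≅ rightLocalization hP.strongPathObjects) ]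

end

end PremodelStructure

/-!
The equivalences are controlled by homotopy classes of maps from cofibrant to fibrant objects.
Bisaturation identifies the acyclic cofibrations and fibrations with the anodyne ones, so that
strong cylinder and path objects give a well-behaved homotopy relation between maps from
a cofibrant object `A` to a fibrant object `Y`. A map between cofibrant objects is called
a homotopy equivalence (`IsHoEquiv`) if it induces bijections on homotopy classes of maps to every
fibrant object, and a left equivalence is a map whose lifts to cofibrant replacements are homotopy
equivalences.

The crucial fact is `IsTwoSided.anoCof_of_isHoEquiv`: a cofibration between cofibrant objects which
is a homotopy equivalence is anodyne. By left saturation it is enough to lift against fibrations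
between fibrant objects, which reduces the claim to bifibrant objects by pushing out along
fibrant replacements. There the cofibration `i : A → B` has a homotopy inverse, which the homotopy
extension property turns into a strict retraction `r`; the homotopy from `r ≫ i` to the identity is
made relative to `A` by means of the relative cylinder object, and a relative deformation
retract lifts against all fibrations. With right saturation it follows that a fibration is a left
equivalence exactly if it is anodyne, and hence that the left equivalences form a left semi-model
structure. Uniqueness holds since, in any such structure, the weak equivalences are determined
by the anodyne maps (`IsLeftSemiModel.le`). The statements on right semi-model structures are
obtained by passing to the opposite category (`IsTwoSided.op`, `isLeftSemiModel_op_iff`).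

Homotopy classes of maps descend to the homotopy category, so that between objects that are fibrant
or cofibrant the equivalences, the left equivalences and the right equivalences all agree
(`IsTwoSided.equivalences_iff_left`, `IsTwoSided.equivalences_iff_right`), and the left and right
equivalences are the maps inverted by the left and right localization functors. If every arrow
can be replaced by an arrow between fibrant objects, the two-out-of-six property applied to the
replacement of `X → Xᶠ` shows that `Xᶜ → X → Xᶠ` is an equivalence; these maps then form an
isomorphism between the two localization functors, so that the left and right equivalences coincide
and form a Quillen model structure.
-/

namespace PremodelStructure

/-! ### The two weak factorization systems -/

section Basic

variable {C : Type u} [Category.{v} C] [HasLimits C] [HasColimits C] (P : PremodelStructure C)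

theorem exists_lift_of_cof_anoFib {A B X Y : C} {i : A ⟶ B} {p : X ⟶ Y} (hi : P.cof i)
    (hp : P.anoFib p) (f : A ⟶ X) (g : B ⟶ Y) (w : f ≫ p = i ≫ g) :
    ∃ l : B ⟶ X, i ≫ l = f ∧ l ≫ p = g := by
  have := P.wfs_cof_anoFib
  have := MorphismProperty.hasLiftingProperty_of_wfs _ _ hi hp
  have sq : CommSq f i p g := ⟨w⟩
  exact ⟨sq.lift, sq.fac_left, sq.fac_right⟩

theorem exists_lift_of_anoCof_fib {A B X Y : C} {i : A ⟶ B} {p : X ⟶ Y} (hi : P.anoCof i)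
    (hp : P.fib p) (f : A ⟶ X) (g : B ⟶ Y) (w : f ≫ p = i ≫ g) :
    ∃ l : B ⟶ X, i ≫ l = f ∧ l ≫ p = g := by
  have := P.wfs_anoCof_fib
  have := MorphismProperty.hasLiftingProperty_of_wfs _ _ hi hp
  have sq : CommSq f i p g := ⟨w⟩
  exact ⟨sq.lift, sq.fac_left, sq.fac_right⟩

theorem exists_fac_cof_anoFib {X Y : C} (f : X ⟶ Y) :
    ∃ (Z : C) (i : X ⟶ Z) (p : Z ⟶ Y), i ≫ p = f ∧ P.cof i ∧ P.anoFib p := by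
  obtain ⟨d⟩ := P.wfs_cof_anoFib.hasFactorization.nonempty_mapFactorizationData f
  exact ⟨d.Z, d.i, d.p, d.fac, d.hi, d.hp⟩

theorem exists_fac_anoCof_fib {X Y : C} (f : X ⟶ Y) :
    ∃ (Z : C) (i : X ⟶ Z) (p : Z ⟶ Y), i ≫ p = f ∧ P.anoCof i ∧ P.fib p := by
  obtain ⟨d⟩ := P.wfs_anoCof_fib.hasFactorization.nonempty_mapFactorizationData f
  exact ⟨d.Z, d.i, d.p, d.fac, d.hi, d.hp⟩

theorem cof_eq_llp : P.cof = P.anoFib.llp := P.wfs_cof_anoFib.llp.symm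
theorem anoFib_eq_rlp : P.anoFib = P.cof.rlp := P.wfs_cof_anoFib.rlp.symm
theorem anoCof_eq_llp : P.anoCof = P.fib.llp := P.wfs_anoCof_fib.llp.symm
theorem fib_eq_rlp : P.fib = P.anoCof.rlp := P.wfs_anoCof_fib.rlp.symm

instance isMultiplicative_cof : P.cof.IsMultiplicative := by rw [cof_eq_llp]; infer_instance
instance isMultiplicative_anoFib : P.anoFib.IsMultiplicative := by
  rw [anoFib_eq_rlp]; infer_instance
instance isMultiplicative_anoCof : P.anoCof.IsMultiplicative := by
  rw [anoCof_eq_llp]; infer_instance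
instance isMultiplicative_fib : P.fib.IsMultiplicative := by rw [fib_eq_rlp]; infer_instance

instance isStableUnderRetracts_cof : P.cof.IsStableUnderRetracts := by
  rw [cof_eq_llp]; infer_instance
instance isStableUnderRetracts_anoFib : P.anoFib.IsStableUnderRetracts := by
  rw [anoFib_eq_rlp]; infer_instance
instance isStableUnderRetracts_fib : P.fib.IsStableUnderRetracts := by
  rw [fib_eq_rlp]; infer_instance

instance isStableUnderCobaseChange_cof : P.cof.IsStableUnderCobaseChange := by
  rw [cof_eq_llp]; infer_instance
instance isStableUnderCobaseChange_anoCof : P.anoCof.IsStableUnderCobaseChange := by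
  rw [anoCof_eq_llp]; infer_instance
instance isStableUnderBaseChange_fib : P.fib.IsStableUnderBaseChange := by
  rw [fib_eq_rlp]; infer_instance

theorem anoFib_le_fib : P.anoFib ≤ P.fib := by
  rw [anoFib_eq_rlp, fib_eq_rlp]
  exact MorphismProperty.antitone_rlp P.anoCof_le_cof

theorem anoCof_le_acyclicCof : P.anoCof ≤ P.acyclicCof := fun _ _ _ hi =>
  ⟨P.anoCof_le_cof _ hi, fun _ _ p _ _ hp => by
    have := P.wfs_anoCof_fib
    exact MorphismProperty.hasLiftingProperty_of_wfs _ p hi hp⟩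

theorem anoFib_le_acyclicFib : P.anoFib ≤ P.acyclicFib := fun _ _ _ hp =>
  ⟨P.anoFib_le_fib _ hp, fun _ _ i _ _ hi => by
    have := P.wfs_cof_anoFib
    exact MorphismProperty.hasLiftingProperty_of_wfs i _ hi hp⟩

end Basic

/-! ### Homotopies between maps from cofibrant to fibrant objects -/

section Homotopy

variable {C : Type u} [Category.{v} C] [HasLimits C] [HasColimits C] (P : PremodelStructure C)

/-- A cylinder object of `A`, with an anodyne (rather than merely acyclic) first leg. -/
structure Cyl (A : C) where
  I : C
  i₀ : A ⟶ I
  i₁ : A ⟶ I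
  s : I ⟶ A
  i₀_s : i₀ ≫ s = 𝟙 A
  i₁_s : i₁ ≫ s = 𝟙 A
  cof : P.cof (coprod.desc i₀ i₁)
  anoCof : P.anoCof i₀

/-- A path object of `Y`, with an anodyne (rather than merely acyclic) first component. -/
structure PathObj (Y : C) where
  E : C
  p₀ : E ⟶ Y
  p₁ : E ⟶ Y
  s : Y ⟶ E
  s_p₀ : s ≫ p₀ = 𝟙 Y
  s_p₁ : s ≫ p₁ = 𝟙 Y
  fib : P.fib (prod.lift p₀ p₁)
  anoFib : P.anoFib p₀

attribute [simp] Cyl.i₀_s Cyl.i₁_s PathObj.s_p₀ PathObj.s_p₁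

/-- Left homotopy, through some cylinder object of the source. -/
def LeftHomotopic {A Y : C} (f g : A ⟶ Y) : Prop :=
  ∃ (c : P.Cyl A) (H : c.I ⟶ Y), c.i₀ ≫ H = f ∧ c.i₁ ≫ H = g

/-- Right homotopy, through some path object of the target. -/
def RightHomotopic {A Y : C} (f g : A ⟶ Y) : Prop :=
  ∃ (e : P.PathObj Y) (k : A ⟶ e.E), k ≫ e.p₀ = f ∧ k ≫ e.p₁ = g

variable {P}

theorem IsTwoSided.nonempty_cyl (hP : P.IsTwoSided) {A : C} (hA : P.IsCofibrant A) :
    Nonempty (P.Cyl A) := by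
  obtain ⟨I, j, s, hjs, hj, hac⟩ := hP.strongCylinders hA
  have e : coprod.desc (coprod.inl ≫ j) (coprod.inr ≫ j) = j := by
    ext <;> simp only [coprod.inl_desc, coprod.inr_desc]
  exact ⟨⟨I, coprod.inl ≫ j, coprod.inr ≫ j, s,
    by rw [Category.assoc, hjs, coprod.inl_desc], by rw [Category.assoc, hjs, coprod.inr_desc],
    by rwa [e], hP.bisaturated.left _ hac⟩⟩

theorem IsTwoSided.nonempty_pathObj (hP : P.IsTwoSided) {Y : C} (hY : P.IsFibrant Y) :
    Nonempty (P.PathObj Y) := by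
  obtain ⟨E, s, q, hsq, hq, hac⟩ := hP.strongPathObjects hY
  have e : prod.lift (q ≫ prod.fst) (q ≫ prod.snd) = q := by
    ext <;> simp only [prod.lift_fst, prod.lift_snd]
  exact ⟨⟨E, q ≫ prod.fst, q ≫ prod.snd, s, by rw [reassoc_of% hsq, prod.lift_fst],
    by rw [reassoc_of% hsq, prod.lift_snd],
    by rwa [e], hP.bisaturated.right _ hac⟩⟩

theorem RightHomotopic.precomp {A B Y : C} (u : A ⟶ B) {f g : B ⟶ Y}
    (h : P.RightHomotopic f g) : P.RightHomotopic (u ≫ f) (u ≫ g) := by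
  obtain ⟨e, k, rfl, rfl⟩ := h
  exact ⟨e, u ≫ k, by simp, by simp⟩

theorem LeftHomotopic.postcomp {A X Y : C} {f g : A ⟶ X} (h : P.LeftHomotopic f g) (u : X ⟶ Y) :
    P.LeftHomotopic (f ≫ u) (g ≫ u) := by
  obtain ⟨c, H, rfl, rfl⟩ := h
  exact ⟨c, H ≫ u, by simp, by simp⟩

theorem IsTwoSided.rightHomotopic_refl (hP : P.IsTwoSided) {A Y : C}
    (hY : P.IsFibrant Y) (f : A ⟶ Y) :
    P.RightHomotopic f f := by
  obtain ⟨e⟩ := hP.nonempty_pathObj hY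
  exact ⟨e, f ≫ e.s, by simp, by simp⟩

/-- A right homotopy can be transported along a left homotopy of its source. The square to be
filled has the right homotopy on one leg of the cylinder and the left homotopy and a constant
one on the two components of the path object. -/
theorem RightHomotopic.of_leftHomotopic {A Y : C} {f f' g : A ⟶ Y} (h : P.RightHomotopic f g)
    (h' : P.LeftHomotopic f f') : P.RightHomotopic f' g := by
  obtain ⟨e, k, hk₀, hk₁⟩ := h
  obtain ⟨c, H, hH₀, hH₁⟩ := h'
  obtain ⟨l, hl, hl'⟩ := P.exists_lift_of_anoCof_fib c.anoCof e.fib k (prod.lift H (c.s ≫ g)) (by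
    ext
    · simp only [Category.assoc, prod.lift_fst, hk₀, hH₀]
    · simp only [Category.assoc, prod.lift_snd, hk₁, reassoc_of% c.i₀_s])
  have h₀ : l ≫ e.p₀ = H := by simpa [prod.lift_fst] using hl' =≫ prod.fst
  have h₁ : l ≫ e.p₁ = c.s ≫ g := by simpa [prod.lift_snd] using hl' =≫ prod.snd
  exact ⟨e, c.i₁ ≫ l, by rw [Category.assoc, h₀, hH₁],
    by rw [Category.assoc, h₁, reassoc_of% c.i₁_s]⟩

theorem IsTwoSided.leftHomotopic_of_rightHomotopic (hP : P.IsTwoSided) {A Y : C}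
    (hA : P.IsCofibrant A) {f g : A ⟶ Y} (h : P.RightHomotopic f g) : P.LeftHomotopic f g := by
  obtain ⟨e, k, hk₀, hk₁⟩ := h
  obtain ⟨c⟩ := hP.nonempty_cyl hA
  obtain ⟨l, hl, hl'⟩ := P.exists_lift_of_cof_anoFib c.cof e.anoFib
    (coprod.desc (f ≫ e.s) k) (c.s ≫ f) (by
      ext <;> simp [hk₀, reassoc_of% c.i₀_s, reassoc_of% c.i₁_s])
  have h₀ : c.i₀ ≫ l = f ≫ e.s := by
    simpa [coprod.inl_desc_assoc, coprod.inl_desc] using coprod.inl ≫= hl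
  have h₁ : c.i₁ ≫ l = k := by
    simpa [coprod.inr_desc_assoc, coprod.inr_desc] using coprod.inr ≫= hl
  exact ⟨c, l ≫ e.p₁, by rw [reassoc_of% h₀, e.s_p₁, Category.comp_id], by rw [reassoc_of% h₁, hk₁]⟩

/-- Right homotopies give left homotopies, and transporting a constant right homotopy along
a left homotopy reverses it; this yields symmetry, and transitivity follows by transport. -/
theorem IsTwoSided.equivalence_rightHomotopic (hP : P.IsTwoSided) {A Y : C}
    (hA : P.IsCofibrant A) (hY : P.IsFibrant Y) :
    Equivalence (P.RightHomotopic : (A ⟶ Y) → (A ⟶ Y) → Prop) where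
  refl := hP.rightHomotopic_refl hY
  symm {f _} h := (hP.rightHomotopic_refl hY f).of_leftHomotopic
    (hP.leftHomotopic_of_rightHomotopic hA h)
  trans {f _ _} h h' := h'.of_leftHomotopic (hP.leftHomotopic_of_rightHomotopic hA
    ((hP.rightHomotopic_refl hY f).of_leftHomotopic (hP.leftHomotopic_of_rightHomotopic hA h)))

theorem IsTwoSided.rightHomotopic_of_leftHomotopic (hP : P.IsTwoSided) {A Y : C}
    (hA : P.IsCofibrant A) (hY : P.IsFibrant Y) {f g : A ⟶ Y} (h : P.LeftHomotopic f g) :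
    P.RightHomotopic f g :=
  (hP.equivalence_rightHomotopic hA hY).symm ((hP.rightHomotopic_refl hY f).of_leftHomotopic h)

/-- Maps identified by an anodyne fibration are homotopic after composition with any map to a
fibrant object. -/
theorem IsTwoSided.rightHomotopic_of_comp_anoFib (hP : P.IsTwoSided) {A X Z Y : C}
    (hA : P.IsCofibrant A) (hY : P.IsFibrant Y) {f g : A ⟶ X} {p : X ⟶ Z} (hp : P.anoFib p)
    (h : f ≫ p = g ≫ p) (u : X ⟶ Y) : P.RightHomotopic (f ≫ u) (g ≫ u) := by
  obtain ⟨c⟩ := hP.nonempty_cyl hA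
  obtain ⟨l, hl, -⟩ := P.exists_lift_of_cof_anoFib c.cof hp (coprod.desc f g) (c.s ≫ f ≫ p) (by
    ext <;> simp [h, reassoc_of% c.i₀_s, reassoc_of% c.i₁_s])
  refine hP.rightHomotopic_of_leftHomotopic hA hY (LeftHomotopic.postcomp ⟨c, l, ?_, ?_⟩ u)
  · simpa [coprod.inl_desc_assoc, coprod.inl_desc] using coprod.inl ≫= hl
  · simpa [coprod.inr_desc_assoc, coprod.inr_desc] using coprod.inr ≫= hl

/-- A right homotopy extends along an anodyne cofibration. -/
theorem RightHomotopic.of_anoCof_comp {A B Y : C} {i : A ⟶ B} (hi : P.anoCof i) {f g : B ⟶ Y}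
    (h : P.RightHomotopic (i ≫ f) (i ≫ g)) : P.RightHomotopic f g := by
  obtain ⟨e, k, hk₀, hk₁⟩ := h
  obtain ⟨l, -, hl⟩ := P.exists_lift_of_anoCof_fib hi e.fib k (prod.lift f g) (by
    ext
    · simp only [Category.assoc, prod.lift_fst, hk₀]
    · simp only [Category.assoc, prod.lift_snd, hk₁])
  exact ⟨e, l, by simpa [prod.lift_fst] using hl =≫ prod.fst,
    by simpa [prod.lift_snd] using hl =≫ prod.snd⟩

/-- The homotopy extension property of cofibrations. -/
theorem RightHomotopic.exists_extension {A B Y : C} {i : A ⟶ B} (hi : P.cof i) {w : B ⟶ Y}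
    {u : A ⟶ Y} (h : P.RightHomotopic (i ≫ w) u) : ∃ w' : B ⟶ Y, i ≫ w' = u := by
  obtain ⟨e, k, hk₀, hk₁⟩ := h
  obtain ⟨l, hl, -⟩ := P.exists_lift_of_cof_anoFib hi e.anoFib k w hk₀
  exact ⟨l ≫ e.p₁, by rw [reassoc_of% hl, hk₁]⟩

/-! ### Homotopy equivalences between cofibrant objects -/

variable (P) in
/-- The set of homotopy classes of maps, used when `A` is cofibrant and `Y` is fibrant. -/
def HoMaps (A Y : C) : Type v := Quot (P.RightHomotopic : (A ⟶ Y) → (A ⟶ Y) → Prop)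

/-- Precomposition on homotopy classes of maps. -/
def HoMaps.precomp {A B : C} (g : A ⟶ B) (Y : C) : P.HoMaps B Y → P.HoMaps A Y :=
  Quot.map (g ≫ ·) fun _ _ h => h.precomp g

theorem HoMaps.precomp_comp {A B D : C} (f : A ⟶ B) (g : B ⟶ D) (Y : C) :
    HoMaps.precomp (P := P) (f ≫ g) Y = HoMaps.precomp f Y ∘ HoMaps.precomp g Y := by
  funext x
  obtain ⟨u⟩ := x
  exact congrArg (Quot.mk _) (Category.assoc f g u)

theorem HoMaps.precomp_id (A Y : C) : HoMaps.precomp (P := P) (𝟙 A) Y = id := by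
  funext x
  obtain ⟨u⟩ := x
  exact congrArg (Quot.mk _) (Category.id_comp u)

theorem IsTwoSided.hoMaps_mk_eq_iff (hP : P.IsTwoSided) {A Y : C}
    (hA : P.IsCofibrant A) (hY : P.IsFibrant Y) (f g : A ⟶ Y) :
    (Quot.mk _ f : P.HoMaps A Y) = Quot.mk _ g ↔ P.RightHomotopic f g :=
  ⟨fun h => (hP.equivalence_rightHomotopic hA hY).eqvGen_iff.1 (Quot.eqvGen_exact h),
    fun h => Quot.sound h⟩

theorem HoMaps.precomp_eq_of_comp_anoFib (hP : P.IsTwoSided) {A X Z Y : C}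
    (hA : P.IsCofibrant A) (hY : P.IsFibrant Y) {f g : A ⟶ X} {p : X ⟶ Z} (hp : P.anoFib p)
    (h : f ≫ p = g ≫ p) : HoMaps.precomp (P := P) f Y = HoMaps.precomp g Y := by
  funext x
  obtain ⟨u⟩ := x
  exact Quot.sound (hP.rightHomotopic_of_comp_anoFib hA hY hp h u)

variable (P) in
/-- A map which induces bijections on homotopy classes of maps to all fibrant objects. This is
the right notion of equivalence for maps between cofibrant objects. -/
def IsHoEquiv {A B : C} (g : A ⟶ B) : Prop :=
  ∀ ⦃Y : C⦄, P.IsFibrant Y → Function.Bijective (HoMaps.precomp (P := P) g Y)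

theorem IsHoEquiv.comp {A B D : C} {f : A ⟶ B} {g : B ⟶ D} (hf : P.IsHoEquiv f)
    (hg : P.IsHoEquiv g) : P.IsHoEquiv (f ≫ g) := fun Y hY => by
  rw [HoMaps.precomp_comp]
  exact (hf hY).comp (hg hY)

theorem IsHoEquiv.of_precomp {A B D : C} {f : A ⟶ B} {g : B ⟶ D} (hf : P.IsHoEquiv f)
    (h : P.IsHoEquiv (f ≫ g)) : P.IsHoEquiv g := fun Y hY => by
  have := h hY
  rwa [HoMaps.precomp_comp, (hf hY).of_comp_iff'] at this

theorem IsHoEquiv.of_postcomp {A B D : C} {f : A ⟶ B} {g : B ⟶ D} (hg : P.IsHoEquiv g)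
    (h : P.IsHoEquiv (f ≫ g)) : P.IsHoEquiv f := fun Y hY => by
  have := h hY
  rwa [HoMaps.precomp_comp, Function.Bijective.of_comp_iff _ (hg hY)] at this

theorem IsTwoSided.isHoEquiv_of_anoFib (hP : P.IsTwoSided) {A B : C} (hA : P.IsCofibrant A)
    (hB : P.IsCofibrant B) {p : A ⟶ B} (hp : P.anoFib p) : P.IsHoEquiv p := fun Y hY => by
  obtain ⟨t, ht⟩ := P.exists_lift_of_anoFib hB p hp (𝟙 B)
  refine Function.bijective_iff_has_inverse.2 ⟨HoMaps.precomp t Y, fun x => ?_, fun x => ?_⟩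
  · rw [← Function.comp_apply (f := HoMaps.precomp t Y), ← HoMaps.precomp_comp, ht,
      HoMaps.precomp_id, id]
  · rw [← Function.comp_apply (f := HoMaps.precomp p Y), ← HoMaps.precomp_comp,
      HoMaps.precomp_eq_of_comp_anoFib hP hA hY hp (g := 𝟙 A) (by simp [ht]),
      HoMaps.precomp_id, id]

theorem IsTwoSided.isHoEquiv_of_anoCof (hP : P.IsTwoSided) {A B : C} (hA : P.IsCofibrant A)
    {i : A ⟶ B} (hi : P.anoCof i) : P.IsHoEquiv i := fun Y hY => by
  have hB := P.isCofibrant_of_cof hA i (P.anoCof_le_cof _ hi)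
  constructor
  · rintro ⟨f⟩ ⟨g⟩ h
    exact (hP.hoMaps_mk_eq_iff hB hY f g).2
      (RightHomotopic.of_anoCof_comp hi ((hP.hoMaps_mk_eq_iff hA hY _ _).1 h))
  · rintro ⟨f⟩
    obtain ⟨g, hg⟩ := P.exists_extension_of_anoCof hY i hi f
    exact ⟨Quot.mk _ g, congrArg (Quot.mk _) hg⟩

/-- A cofibration to a fibrant object which is a deformation retract lifts against all
fibrations. The homotopy `k` is made relative to `A` by lifting the pair `(k ∘ i ∘ r, k)`, whose
components agree on `A`, to the relative cylinder object of `i`. -/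
theorem anoCof_of_deformationRetract (hP : P.IsTwoSided) {A B : C} (hA : P.IsCofibrant A)
    (hB : P.IsFibrant B) {i : A ⟶ B} (hi : P.cof i) {r : B ⟶ A} (hr : i ≫ r = 𝟙 A)
    (h : P.RightHomotopic (r ≫ i) (𝟙 B)) : P.anoCof i := by
  obtain ⟨e, k, hk₀, hk₁⟩ := h
  obtain ⟨J, j, s, hjs, hj, hac⟩ := hP.weakModel.cylinder i hA hB hi
  obtain ⟨l, hl, -⟩ := P.exists_lift_of_cof_anoFib hj e.anoFib
    (pushout.desc (r ≫ i ≫ k) k (by rw [reassoc_of% hr])) (s ≫ r ≫ i) (by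
      rw [reassoc_of% hjs]
      ext
      · simp only [pushout.inl_desc_assoc, Category.assoc, hk₀, reassoc_of% hr, Category.id_comp]
      · simp only [pushout.inr_desc_assoc, hk₀, Category.id_comp])
  have hl₀ : pushout.inl i i ≫ j ≫ l = r ≫ i ≫ k := by rw [hl, pushout.inl_desc]
  have hl₁ : pushout.inr i i ≫ j ≫ l = k := by rw [hl, pushout.inr_desc]
  rw [anoCof_eq_llp]
  intro X Y p hp
  refine ⟨fun {u v} sq => ?_⟩
  obtain ⟨m, hm, hm'⟩ := P.exists_lift_of_anoCof_fib (hP.bisaturated.left _ hac) hp (r ≫ u)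
    (l ≫ e.p₁ ≫ v) (by
      rw [Category.assoc, Category.assoc, reassoc_of% hl₀, reassoc_of% hk₁, sq.w])
  refine ⟨⟨⟨pushout.inr i i ≫ j ≫ m, ?_, ?_⟩⟩⟩
  · rw [← pushout.condition_assoc]
    rw [Category.assoc] at hm
    rw [hm, reassoc_of% hr]
  · rw [Category.assoc, Category.assoc, hm', reassoc_of% hl₁, reassoc_of% hk₁]

/-- Cofibrations between cofibrant objects that are equivalences are anodyne. -/
theorem IsTwoSided.anoCof_of_isHoEquiv (hP : P.IsTwoSided) {A B : C} (hA : P.IsCofibrant A)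
    {i : A ⟶ B} (hi : P.cof i) (h : P.IsHoEquiv i) : P.anoCof i := by
  have hB := P.isCofibrant_of_cof hA i hi
  obtain ⟨A', a, hA', ha⟩ := P.exists_fibrantReplacement A
  obtain ⟨B', b, hB', hb⟩ := P.exists_fibrantReplacement (pushout i a)
  have hA'c := P.isCofibrant_of_cof hA a (P.anoCof_le_cof _ ha)
  have hinl : P.anoCof (pushout.inl i a) := P.anoCof.pushout_inl _ _ ha
  have hinr : P.cof (pushout.inr i a) := P.cof.pushout_inr _ _ hi
  -- `i'` is a cofibration between bifibrant objects into which `i` is embedded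
  let i' : A' ⟶ B' := pushout.inr i a ≫ b
  have hi' : P.cof i' := P.cof.comp_mem _ _ hinr (P.anoCof_le_cof _ hb)
  have hB'c := P.isCofibrant_of_cof hA'c i' hi'
  have hbb : P.anoCof (pushout.inl i a ≫ b) := P.anoCof.comp_mem _ _ hinl hb
  have w : a ≫ i' = i ≫ pushout.inl i a ≫ b := by simp [i', pushout.condition_assoc]
  have hi'e : P.IsHoEquiv i' := by
    refine (hP.isHoEquiv_of_anoCof hA ha).of_precomp ?_
    rw [w]
    exact h.comp (hP.isHoEquiv_of_anoCof hB hbb)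
  obtain ⟨⟨r₀⟩, hr₀⟩ := (hi'e hA').2 (Quot.mk _ (𝟙 A'))
  obtain ⟨r, hr⟩ := ((hP.hoMaps_mk_eq_iff hA'c hA' _ _).1 hr₀).exists_extension hi'
  have hr' : P.RightHomotopic (r ≫ i') (𝟙 B') := by
    rw [← hP.hoMaps_mk_eq_iff hB'c hB']
    refine (hi'e hB').1 (congrArg (Quot.mk _) ?_)
    simp [reassoc_of% hr]
  have hi'a := anoCof_of_deformationRetract hP hA'c hB' hi' hr hr'
  -- a lifting problem for `i` against a fibration between fibrant objects extends to one for `i'`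
  refine hP.bisaturated.left _ ⟨hi, fun X Y p hX hY hp => ⟨fun {f g} sq => ?_⟩⟩
  obtain ⟨f', hf'⟩ := P.exists_extension_of_anoCof hX a ha f
  obtain ⟨g', hg'⟩ := P.exists_extension_of_anoCof hY b hb
    (pushout.desc g (f' ≫ p) (by rw [reassoc_of% hf', sq.w]))
  obtain ⟨l, hl, hl'⟩ := P.exists_lift_of_anoCof_fib hi'a hp f' g'
    (by rw [Category.assoc, hg', pushout.inr_desc])
  exact ⟨⟨⟨pushout.inl i a ≫ b ≫ l, by rw [← reassoc_of% w, hl, hf'],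
    by rw [Category.assoc, Category.assoc, hl', hg', pushout.inl_desc]⟩⟩⟩

end Homotopy

/-! ### The left equivalences -/

section LeftEquivalences

variable {C : Type u} [Category.{v} C] [HasLimits C] [HasColimits C] {P : PremodelStructure C}

/-- The functor sending `X` to the homotopy classes of maps from a cofibrant replacement of `X`
to a fibrant object `Y`. -/
noncomputable def IsTwoSided.hoMapsFunctor (hP : P.IsTwoSided) {Y : C} (hY : P.IsFibrant Y) :
    C ⥤ (Type v)ᵒᵖ where
  obj X := Opposite.op (P.HoMaps (P.cofRep X) Y)
  map f := Quiver.Hom.op (TypeCat.ofHom (HoMaps.precomp (P.cofRepLift f) Y))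
  map_id X := by
    rw [HoMaps.precomp_eq_of_comp_anoFib hP (P.cofRep_isCofibrant X) hY
      (P.cofRepMap_anoFib X) (g := 𝟙 _) (by simp [cofRepLift_comp]), HoMaps.precomp_id]
    rfl
  map_comp {X X' X''} f g := by
    rw [HoMaps.precomp_eq_of_comp_anoFib hP (P.cofRep_isCofibrant X) hY
      (P.cofRepMap_anoFib X'') (g := P.cofRepLift f ≫ P.cofRepLift g), HoMaps.precomp_comp]
    · rfl
    · rw [Category.assoc, cofRepLift_comp, cofRepLift_comp, ← Category.assoc, ← Category.assoc,
        cofRepLift_comp]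

/-- The left equivalences: the maps that induce bijections on homotopy classes of maps from
cofibrant replacements to fibrant objects. -/
def IsTwoSided.leftEquivalences (hP : P.IsTwoSided) : MorphismProperty C := fun _ _ f =>
  ∀ ⦃Y : C⦄ (hY : P.IsFibrant Y), IsIso ((hP.hoMapsFunctor hY).map f)

theorem IsTwoSided.leftEquivalences_iff (hP : P.IsTwoSided) {A B : C} (f : A ⟶ B) :
    hP.leftEquivalences f ↔ P.IsHoEquiv (P.cofRepLift f) := by
  refine forall_congr' fun Y => forall_congr' fun hY => ?_
  refine (isIso_op_iff _).trans ((isIso_iff_bijective _).trans ?_)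
  rfl

theorem IsTwoSided.leftEquivalences_iff_of_isCofibrant (hP : P.IsTwoSided) {A B : C}
    (hA : P.IsCofibrant A) (hB : P.IsCofibrant B) (f : A ⟶ B) :
    hP.leftEquivalences f ↔ P.IsHoEquiv f := by
  rw [leftEquivalences_iff]
  have hA' := hP.isHoEquiv_of_anoFib (P.cofRep_isCofibrant A) hA (P.cofRepMap_anoFib A)
  have hB' := hP.isHoEquiv_of_anoFib (P.cofRep_isCofibrant B) hB (P.cofRepMap_anoFib B)
  constructor
  · intro h
    exact hA'.of_precomp (by rw [← cofRepLift_comp]; exact h.comp hB')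
  · intro h
    exact hB'.of_postcomp (by rw [cofRepLift_comp]; exact hA'.comp h)

instance (hP : P.IsTwoSided) : hP.leftEquivalences.HasTwoOutOfThreeProperty where
  comp_mem f g hf hg Y hY := by
    have := hf hY
    have := hg hY
    rw [Functor.map_comp]
    infer_instance
  of_postcomp f g hg hfg Y hY := by
    have := hg hY
    have := hfg hY
    rw [Functor.map_comp] at this
    exact IsIso.of_isIso_comp_right _ ((hP.hoMapsFunctor hY).map g)
  of_precomp f g hf hfg Y hY := by
    have := hf hY
    have := hfg hY
    rw [Functor.map_comp] at this
    exact IsIso.of_isIso_comp_left ((hP.hoMapsFunctor hY).map f) _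

instance (hP : P.IsTwoSided) : hP.leftEquivalences.IsStableUnderRetracts where
  of_retract h hg _ hY := MorphismProperty.of_retract
    (P := (MorphismProperty.isomorphisms _).inverseImage (hP.hoMapsFunctor hY)) h (hg hY)

theorem IsTwoSided.anoFib_le_leftEquivalences (hP : P.IsTwoSided) :
    P.anoFib ≤ hP.leftEquivalences := fun X Y p hp => by
  rw [leftEquivalences_iff]
  -- both `cofRep X → Y` and `cofRep Y → Y` are cofibrant replacements of `Y`
  obtain ⟨t, ht⟩ := P.exists_lift_of_anoFib (P.cofRep_isCofibrant Y) _
    (P.anoFib.comp_mem _ _ (P.cofRepMap_anoFib X) hp) (P.cofRepMap Y)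
  -- an endomorphism of a cofibrant replacement of `Z` over `Z` is homotopic to the identity
  have hc {A B Z : C} (hA : P.IsCofibrant A) (u : A ⟶ B) (w : B ⟶ A) (q : A ⟶ Z)
      (hq : P.anoFib q) (h : u ≫ w ≫ q = q) : P.IsHoEquiv (u ≫ w) := fun E hE => by
    rw [HoMaps.precomp_eq_of_comp_anoFib hP hA hE hq (g := 𝟙 A) (by simpa using h),
      HoMaps.precomp_id]
    exact Function.bijective_id
  have h₁ := hc (P.cofRep_isCofibrant X) (P.cofRepLift p) t _
    (P.anoFib.comp_mem _ _ (P.cofRepMap_anoFib X) hp) (by rw [ht, cofRepLift_comp])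
  have h₂ := hc (P.cofRep_isCofibrant Y) t (P.cofRepLift p) _
    (P.cofRepMap_anoFib Y) (by rw [cofRepLift_comp, ht])
  intro E hE
  have h₁' := h₁ hE
  have h₂' := h₂ hE
  rw [HoMaps.precomp_comp] at h₁' h₂'
  exact ⟨h₂'.1.of_comp, h₁'.2.of_comp⟩

theorem IsTwoSided.leftEquivalences_of_anoCof (hP : P.IsTwoSided) {A B : C}
    (hA : P.IsCofibrant A) {i : A ⟶ B} (hi : P.anoCof i) : hP.leftEquivalences i :=
  (hP.leftEquivalences_iff_of_isCofibrant hA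
    (P.isCofibrant_of_cof hA i (P.anoCof_le_cof _ hi)) i).2 (hP.isHoEquiv_of_anoCof hA hi)

theorem IsTwoSided.anoCof_of_leftEquivalences (hP : P.IsTwoSided) {A B : C}
    (hA : P.IsCofibrant A) {i : A ⟶ B} (hi : P.cof i) (h : hP.leftEquivalences i) :
    P.anoCof i :=
  hP.anoCof_of_isHoEquiv hA hi ((hP.leftEquivalences_iff_of_isCofibrant hA
    (P.isCofibrant_of_cof hA i hi) i).1 h)

/-- A fibration that is a left equivalence is anodyne. After pulling back to a cofibrant
replacement of the target, and replacing the source, it is a map between cofibrant objects; the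
cofibration in its factorization is then anodyne and the retract argument applies. -/
theorem IsTwoSided.anoFib_of_leftEquivalences (hP : P.IsTwoSided) {X Y : C} {p : X ⟶ Y}
    (hp : P.fib p) (h : hP.leftEquivalences p) : P.anoFib p := by
  refine hP.bisaturated.right _ ⟨hp, fun A B i hA hB hi => ⟨fun {f g} sq => ?_⟩⟩
  have hq : P.anoFib (pullback.fst p (P.cofRepMap Y)) := by
    rw [anoFib_eq_rlp]
    exact MorphismProperty.pullback_fst _ _ (by rw [← anoFib_eq_rlp]; exact P.cofRepMap_anoFib Y)
  have hp' : P.fib (pullback.snd p (P.cofRepMap Y)) := P.fib.pullback_snd _ _ hp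
  set Z := pullback p (P.cofRepMap Y)
  set q : Z ⟶ X := pullback.fst _ _
  set p' : Z ⟶ P.cofRep Y := pullback.snd _ _
  have w : q ≫ p = p' ≫ P.cofRepMap Y := pullback.condition
  have hfib : P.fib (P.cofRepMap Z ≫ p') :=
    P.fib.comp_mem _ _ (P.anoFib_le_fib _ (P.cofRepMap_anoFib Z)) hp'
  have hW : hP.leftEquivalences (P.cofRepMap Z ≫ p') := by
    refine hP.leftEquivalences.of_postcomp _ _
      (hP.anoFib_le_leftEquivalences _ (P.cofRepMap_anoFib Y)) ?_
    rw [Category.assoc, ← w]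
    exact hP.leftEquivalences.comp_mem _ _
      (hP.anoFib_le_leftEquivalences _ (P.cofRepMap_anoFib Z))
      (hP.leftEquivalences.comp_mem _ _ (hP.anoFib_le_leftEquivalences _ hq) h)
  obtain ⟨T, j, r, hjr, hj, hr⟩ := P.exists_fac_cof_anoFib (P.cofRepMap Z ≫ p')
  have hj' : P.anoCof j := by
    refine hP.anoCof_of_leftEquivalences (P.cofRep_isCofibrant Z) hj
      (hP.leftEquivalences.of_postcomp _ _ (hP.anoFib_le_leftEquivalences _ hr) ?_)
    rw [hjr]
    exact hW
  have hano : P.anoFib (P.cofRepMap Z ≫ p') := by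
    have := P.wfs_anoCof_fib
    have := MorphismProperty.hasLiftingProperty_of_wfs j _ hj' hfib
    exact MorphismProperty.of_retract (RetractArrow.ofRightLiftingProperty hjr) hr
  obtain ⟨g', hg'⟩ := P.exists_lift_of_anoFib hB _ (P.cofRepMap_anoFib Y) g
  obtain ⟨f', hf'⟩ := P.exists_lift_of_anoFib hA _ (P.cofRepMap_anoFib Z)
    (pullback.lift f (i ≫ g') (by rw [Category.assoc, hg', sq.w]))
  obtain ⟨l, hl, hl'⟩ := P.exists_lift_of_cof_anoFib hi hano f' g'
    (by rw [reassoc_of% hf', pullback.lift_snd])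
  exact ⟨⟨⟨l ≫ P.cofRepMap Z ≫ q, by rw [reassoc_of% hl, reassoc_of% hf', pullback.lift_fst],
    by rw [Category.assoc, Category.assoc, w, reassoc_of% hl', hg']⟩⟩⟩

theorem IsTwoSided.fib_inf_leftEquivalences (hP : P.IsTwoSided) :
    P.fib ⊓ hP.leftEquivalences = P.anoFib :=
  le_antisymm (fun _ _ _ h => hP.anoFib_of_leftEquivalences h.1 h.2)
    (le_inf P.anoFib_le_fib hP.anoFib_le_leftEquivalences)

theorem IsTwoSided.isLeftSemiModel_leftEquivalences (hP : P.IsTwoSided) :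
    P.IsLeftSemiModel hP.leftEquivalences where
  twoOutOfThree := inferInstance
  retract_W := inferInstance
  retract_cof := inferInstance
  retract_fib := inferInstance
  fac_cof_trivFib _ _ f _ := by
    obtain ⟨Z, i, p, h, hi, hp⟩ := P.exists_fac_cof_anoFib f
    exact ⟨Z, i, p, h, hi, P.anoFib_le_fib _ hp, hP.anoFib_le_leftEquivalences _ hp⟩
  fac_trivCof_fib _ _ f hX := by
    obtain ⟨Z, i, p, h, hi, hp⟩ := P.exists_fac_anoCof_fib f
    exact ⟨Z, i, p, h, P.anoCof_le_cof _ hi, hP.leftEquivalences_of_anoCof hX hi, hp⟩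
  lift _ _ _ _ i p hA hi hp h := by
    have := P.wfs_cof_anoFib
    have := P.wfs_anoCof_fib
    obtain h | h := h
    · exact MorphismProperty.hasLiftingProperty_of_wfs i p
        (hP.anoCof_of_leftEquivalences hA hi h) hp
    · exact MorphismProperty.hasLiftingProperty_of_wfs i p hi
        (hP.anoFib_of_leftEquivalences hp h)
  fib_baseChange := inferInstance
  initial_cofibrant := by
    rw [IsCofibrant, Subsingleton.elim (initial.to (⊥_ C)) (𝟙 _)]
    exact P.cof.id_mem _
  wfs := by
    rw [fib_inf_leftEquivalences]
    exact P.wfs_cof_anoFib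

/-! ### Properties of an arbitrary left semi-model structure -/

theorem IsLeftSemiModel.fib_inf {W : MorphismProperty C} (hW : P.IsLeftSemiModel W) :
    P.fib ⊓ W = P.anoFib := by
  rw [anoFib_eq_rlp, hW.wfs.rlp]

theorem IsLeftSemiModel.anoFib_le {W : MorphismProperty C} (hW : P.IsLeftSemiModel W) :
    P.anoFib ≤ W := by
  rw [← hW.fib_inf]
  exact inf_le_right

/-- Among cofibrations with cofibrant domain, the members of a left semi-model class are the
anodyne cofibrations, whatever the class. -/
theorem IsLeftSemiModel.anoCof_iff {W : MorphismProperty C} (hW : P.IsLeftSemiModel W) {A B : C}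
    (hA : P.IsCofibrant A) {i : A ⟶ B} (hi : P.cof i) : P.anoCof i ↔ W i := by
  constructor
  · intro h
    obtain ⟨Z, j, p, hjp, hj, hjW, hp⟩ := hW.fac_trivCof_fib i hA
    have := P.wfs_anoCof_fib
    have := MorphismProperty.hasLiftingProperty_of_wfs i p h hp
    have := hW.retract_W
    exact MorphismProperty.of_retract (RetractArrow.ofLeftLiftingProperty hjp) hjW
  · intro h
    rw [anoCof_eq_llp]
    exact fun _ _ p hp => hW.lift i p hA hi hp (Or.inl h)

/-- The class of a left semi-model structure is unique: replacing the source of `f` by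
a cofibrant object and factoring reduces membership of `f` to that of a cofibration with
cofibrant domain. -/
theorem IsLeftSemiModel.le {W W' : MorphismProperty C} (hW : P.IsLeftSemiModel W)
    (hW' : P.IsLeftSemiModel W') : W ≤ W' := fun X Y f hf => by
  have := hW.twoOutOfThree
  have := hW'.twoOutOfThree
  obtain ⟨Z, i, q, hiq, hi, hq⟩ := P.exists_fac_cof_anoFib (P.cofRepMap X ≫ f)
  have hiW : W i := W.of_postcomp _ _ (hW.anoFib_le _ hq) (by
    rw [hiq]
    exact W.comp_mem _ _ (hW.anoFib_le _ (P.cofRepMap_anoFib X)) hf)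
  refine W'.of_precomp _ _ (hW'.anoFib_le _ (P.cofRepMap_anoFib X)) ?_
  rw [← hiq]
  exact W'.comp_mem _ _ ((hW'.anoCof_iff (P.cofRep_isCofibrant X) hi).1
    ((hW.anoCof_iff (P.cofRep_isCofibrant X) hi).2 hiW)) (hW'.anoFib_le _ hq)

end LeftEquivalences

/-! ### Duality -/

section Duality

open Opposite

variable {C : Type u} [Category.{v} C]

theorem rlp_op (T : MorphismProperty C) : T.op.rlp = T.llp.op := by
  ext X Y f
  exact ⟨fun h _ _ g hg => (h g.op hg).unop, fun h _ _ g hg => (h g.unop hg).op⟩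

theorem llp_op (T : MorphismProperty C) : T.op.llp = T.rlp.op := by
  ext X Y f
  exact ⟨fun h _ _ g hg => (h g.op hg).unop, fun h _ _ g hg => (h g.unop hg).op⟩

theorem isWeakFactorizationSystem_op_iff {W₁ W₂ : MorphismProperty C} :
    MorphismProperty.IsWeakFactorizationSystem W₂.op W₁.op ↔
      MorphismProperty.IsWeakFactorizationSystem W₁ W₂ := by
  constructor
  · intro h
    refine ⟨?_, ?_, ⟨fun f => ?_⟩⟩
    · have := h.llp
      rw [llp_op] at this
      exact congrArg MorphismProperty.unop this
    · have := h.rlp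
      rw [rlp_op] at this
      exact congrArg MorphismProperty.unop this
    · obtain ⟨d⟩ := h.hasFactorization.nonempty_mapFactorizationData f.op
      exact ⟨d.unop⟩
  · intro h
    exact ⟨by rw [rlp_op, h.llp], by rw [llp_op, h.rlp], inferInstance⟩

variable [HasLimits C] [HasColimits C] (P : PremodelStructure C)

/-- The opposite premodel structure, in which cofibrations and fibrations are exchanged. -/
def op : PremodelStructure Cᵒᵖ where
  cof := P.fib.op
  anoFib := P.anoCof.op
  anoCof := P.anoFib.op
  fib := P.cof.op
  wfs_cof_anoFib := isWeakFactorizationSystem_op_iff.2 P.wfs_anoCof_fib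
  wfs_anoCof_fib := isWeakFactorizationSystem_op_iff.2 P.wfs_cof_anoFib
  anoCof_le_cof _ _ _ h := P.anoFib_le_fib _ h

theorem isCofibrant_op_iff (X : Cᵒᵖ) : P.op.IsCofibrant X ↔ P.IsFibrant X.unop := by
  let e : (⊥_ Cᵒᵖ).unop ≅ ⊤_ C :=
    (terminalUnopOfInitial initialIsInitial).uniqueUpToIso terminalIsTerminal
  have h : terminal.from X.unop = (initial.to X).unop ≫ e.hom := Subsingleton.elim _ _
  rw [IsFibrant, h, P.fib.cancel_right_of_respectsIso]
  rfl

theorem isFibrant_op_iff (X : Cᵒᵖ) : P.op.IsFibrant X ↔ P.IsCofibrant X.unop := by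
  let e : ⊥_ C ≅ (⊤_ Cᵒᵖ).unop :=
    initialIsInitial.uniqueUpToIso (initialUnopOfTerminal terminalIsTerminal)
  have h : initial.to X.unop = e.hom ≫ (terminal.from X).unop := Subsingleton.elim _ _
  rw [IsCofibrant, h, P.cof.cancel_left_of_respectsIso]
  rfl

theorem acyclicCof_op_iff {X Y : Cᵒᵖ} (f : X ⟶ Y) :
    P.op.acyclicCof f ↔ P.acyclicFib f.unop := by
  refine and_congr Iff.rfl ⟨fun h A B i hA hB hi => ?_, fun h A B i hA hB hi => ?_⟩
  · exact (h i.op ((P.isFibrant_op_iff _).2 hB) ((P.isFibrant_op_iff _).2 hA) hi).unop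
  · exact (h i.unop ((P.isFibrant_op_iff _).1 hB) ((P.isFibrant_op_iff _).1 hA) hi).op

theorem acyclicFib_op_iff {X Y : Cᵒᵖ} (f : X ⟶ Y) :
    P.op.acyclicFib f ↔ P.acyclicCof f.unop := by
  refine and_congr Iff.rfl ⟨fun h A B i hA hB hi => ?_, fun h A B i hA hB hi => ?_⟩
  · exact (h i.op ((P.isCofibrant_op_iff _).2 hB) ((P.isCofibrant_op_iff _).2 hA) hi).unop
  · exact (h i.unop ((P.isCofibrant_op_iff _).1 hB) ((P.isCofibrant_op_iff _).1 hA) hi).op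

variable {P}

theorem IsTwoSided.op (hP : P.IsTwoSided) : P.op.IsTwoSided where
  weakModel :=
    { cylinder A X i hA hX hi := by
        obtain ⟨E, s, q, hsq, hq, hac⟩ := hP.weakModel.path i.unop
          ((P.isFibrant_op_iff _).1 hX) ((P.isCofibrant_op_iff _).1 hA) hi
        refine ⟨Opposite.op E, (pushoutIsoOpPullback i i).hom ≫ q.op, s.op, ?_, ?_, ?_⟩
        · rw [Category.assoc, ← op_comp, hsq]
          apply pushout.hom_ext
          · rw [pushoutIsoOpPullback_inl_hom_assoc, ← op_comp, pullback.lift_fst, pushout.inl_desc]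
            rfl
          · rw [pushoutIsoOpPullback_inr_hom_assoc, ← op_comp, pullback.lift_snd, pushout.inr_desc]
            rfl
        · rw [P.op.cof.cancel_left_of_respectsIso]
          exact hq
        · rw [acyclicCof_op_iff, pushoutIsoOpPullback_inl_hom_assoc]
          exact hac
      path A X p hA hX hp := by
        obtain ⟨I, j, s, hjs, hj, hac⟩ := hP.weakModel.cylinder p.unop
          ((P.isFibrant_op_iff _).1 hX) ((P.isCofibrant_op_iff _).1 hA) hp
        refine ⟨Opposite.op I, s.op, j.op ≫ (pullbackIsoOpPushout p p).inv, ?_, ?_, ?_⟩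
        · rw [← Category.assoc, ← op_comp, hjs]
          apply pullback.hom_ext
          · rw [Category.assoc, pullbackIsoOpPushout_inv_fst, ← op_comp, pushout.inl_desc,
              pullback.lift_fst]
            rfl
          · rw [Category.assoc, pullbackIsoOpPushout_inv_snd, ← op_comp, pushout.inr_desc,
              pullback.lift_snd]
            rfl
        · rw [P.op.fib.cancel_right_of_respectsIso]
          exact hj
        · rw [acyclicFib_op_iff, Category.assoc, pullbackIsoOpPushout_inv_fst]
          exact hac }
  strongPathObjects Y hY := by
    obtain ⟨I, j, s, hjs, hj, hac⟩ := hP.strongCylinders ((P.isFibrant_op_iff _).1 hY)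
    refine ⟨Opposite.op I, s.op, j.op ≫ prod.lift coprod.inl.op coprod.inr.op, ?_, ?_, ?_⟩
    · rw [← Category.assoc, ← op_comp, hjs]
      apply Limits.prod.hom_ext
      · rw [Category.assoc, prod.lift_fst, ← op_comp, coprod.inl_desc, prod.lift_fst]
        rfl
      · rw [Category.assoc, prod.lift_snd, ← op_comp, coprod.inr_desc, prod.lift_snd]
        rfl
    · have : IsIso (prod.lift (coprod.inl (X := Y.unop) (Y := Y.unop)).op coprod.inr.op) := by
        refine ⟨(coprod.desc prod.fst.unop prod.snd.unop).op, ?_, ?_⟩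
        · apply Quiver.Hom.unop_inj
          apply coprod.hom_ext
          · rw [unop_comp, Quiver.Hom.unop_op, coprod.inl_desc_assoc, ← unop_comp, prod.lift_fst]
            exact (Category.comp_id _).symm
          · rw [unop_comp, Quiver.Hom.unop_op, coprod.inr_desc_assoc, ← unop_comp, prod.lift_snd]
            exact (Category.comp_id _).symm
        · apply Limits.prod.hom_ext
          · rw [Category.assoc, prod.lift_fst, ← op_comp, coprod.inl_desc]
            exact (Category.id_comp _).symm
          · rw [Category.assoc, prod.lift_snd, ← op_comp, coprod.inr_desc]
            exact (Category.id_comp _).symm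
      rw [P.op.fib.cancel_right_of_respectsIso]
      exact hj
    · rw [acyclicFib_op_iff, Category.assoc, prod.lift_fst]
      exact hac
  strongCylinders X hX := by
    obtain ⟨E, s, q, hsq, hq, hac⟩ := hP.strongPathObjects ((P.isCofibrant_op_iff _).1 hX)
    refine ⟨Opposite.op E, coprod.desc prod.fst.op prod.snd.op ≫ q.op, s.op, ?_, ?_, ?_⟩
    · rw [Category.assoc, ← op_comp, hsq]
      apply coprod.hom_ext
      · rw [coprod.inl_desc_assoc, ← op_comp, prod.lift_fst, coprod.inl_desc]
        rfl
      · rw [coprod.inr_desc_assoc, ← op_comp, prod.lift_snd, coprod.inr_desc]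
        rfl
    · have e : coprod.desc prod.fst.op prod.snd.op = (opProdIsoCoprod X.unop X.unop).inv := by
        apply coprod.hom_ext
        · rw [coprod.inl_desc]
          exact inl_opProdIsoCoprod_inv.symm
        · rw [coprod.inr_desc]
          exact inr_opProdIsoCoprod_inv.symm
      have : IsIso (coprod.desc (prod.fst (X := X.unop) (Y := X.unop)).op prod.snd.op) := by
        rw [e]
        infer_instance
      rw [P.op.cof.cancel_left_of_respectsIso]
      exact hq
    · rw [acyclicCof_op_iff, coprod.inl_desc_assoc]
      exact hac
  bisaturated :=
    { left _ _ f hf := hP.bisaturated.right _ ((P.acyclicCof_op_iff f).1 hf)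
      right _ _ f hf := hP.bisaturated.left _ ((P.acyclicFib_op_iff f).1 hf) }

/-- Right semi-model structures are left semi-model structures on the opposite category. -/
theorem isLeftSemiModel_op_iff {W : MorphismProperty C} :
    P.op.IsLeftSemiModel W.op ↔ P.IsRightSemiModel W := by
  constructor
  · intro h
    have h₁ := h.twoOutOfThree
    have h₂ := h.retract_W
    exact
      { twoOutOfThree := inferInstanceAs W.op.unop.HasTwoOutOfThreeProperty
        retract_W := inferInstanceAs W.op.unop.IsStableUnderRetracts
        retract_cof := inferInstance
        retract_fib := inferInstance
        fac_trivCof_fib X Y f hY := by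
          obtain ⟨Z, i, p, hf, hi, hp, hW⟩ :=
            h.fac_cof_trivFib f.op ((P.isCofibrant_op_iff _).2 hY)
          exact ⟨Z.unop, p.unop, i.unop, Quiver.Hom.op_inj hf, hp, hW, hi⟩
        fac_cof_trivFib X Y f hY := by
          obtain ⟨Z, i, p, hf, hi, hW, hp⟩ :=
            h.fac_trivCof_fib f.op ((P.isCofibrant_op_iff _).2 hY)
          exact ⟨Z.unop, p.unop, i.unop, Quiver.Hom.op_inj hf, hp, hi, hW⟩
        lift A B X Y i p hi hY hp hW :=
          (h.lift p.op i.op ((P.isCofibrant_op_iff _).2 hY) hp hi hW.symm).unop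
        cof_cobaseChange := inferInstance
        terminal_fibrant := by
          rw [IsFibrant, Subsingleton.elim (terminal.from (⊤_ C)) (𝟙 _)]
          exact P.fib.id_mem _
        wfs := isWeakFactorizationSystem_op_iff.1 h.wfs }
  · intro h
    have h₁ := h.twoOutOfThree
    have h₂ := h.retract_W
    exact
      { twoOutOfThree := inferInstance
        retract_W := inferInstance
        retract_cof := inferInstance
        retract_fib := inferInstance
        fac_trivCof_fib X Y f hY := by
          obtain ⟨Z, i, p, hf, hi, hp, hW⟩ :=
            h.fac_cof_trivFib f.unop ((P.isCofibrant_op_iff _).1 hY)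
          exact ⟨Opposite.op Z, p.op, i.op, Quiver.Hom.unop_inj hf, hp, hW, hi⟩
        fac_cof_trivFib X Y f hY := by
          obtain ⟨Z, i, p, hf, hi, hW, hp⟩ :=
            h.fac_trivCof_fib f.unop ((P.isCofibrant_op_iff _).1 hY)
          exact ⟨Opposite.op Z, p.op, i.op, Quiver.Hom.unop_inj hf, hp, hi, hW⟩
        lift A B X Y i p hA hi hp hW :=
          (h.lift p.unop i.unop hp ((P.isCofibrant_op_iff _).1 hA) hi hW.symm).op
        fib_baseChange := inferInstance
        initial_cofibrant := by
          rw [IsCofibrant, Subsingleton.elim (initial.to (⊥_ Cᵒᵖ)) (𝟙 _)]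
          exact P.op.cof.id_mem _
        wfs := isWeakFactorizationSystem_op_iff.2 h.wfs }

/-- The right equivalences, as the left equivalences of the opposite category. -/
def IsTwoSided.rightEquivalences (hP : P.IsTwoSided) : MorphismProperty C :=
  hP.op.leftEquivalences.unop

theorem IsTwoSided.isRightSemiModel_rightEquivalences (hP : P.IsTwoSided) :
    P.IsRightSemiModel hP.rightEquivalences :=
  isLeftSemiModel_op_iff.1 hP.op.isLeftSemiModel_leftEquivalences

theorem IsRightSemiModel.cof_inf {W : MorphismProperty C} (hW : P.IsRightSemiModel W) :
    P.cof ⊓ W = P.anoCof :=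
  congrArg MorphismProperty.unop (isLeftSemiModel_op_iff.2 hW).fib_inf

theorem IsRightSemiModel.anoCof_le {W : MorphismProperty C} (hW : P.IsRightSemiModel W) :
    P.anoCof ≤ W := by
  rw [← hW.cof_inf]
  exact inf_le_right

theorem IsRightSemiModel.anoFib_iff {W : MorphismProperty C} (hW : P.IsRightSemiModel W)
    {X Y : C} (hY : P.IsFibrant Y) {p : X ⟶ Y} (hp : P.fib p) : P.anoFib p ↔ W p :=
  (isLeftSemiModel_op_iff.2 hW).anoCof_iff (i := p.op) ((P.isCofibrant_op_iff _).2 hY) hp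

theorem IsRightSemiModel.le {W W' : MorphismProperty C} (hW : P.IsRightSemiModel W)
    (hW' : P.IsRightSemiModel W') : W ≤ W' := fun _ _ f hf =>
  (isLeftSemiModel_op_iff.2 hW).le (isLeftSemiModel_op_iff.2 hW') f.op hf

end Duality

/-! ### Equivalences in the homotopy category -/

section Ho

variable {C : Type u} [Category.{v} C] [HasLimits C] [HasColimits C] {P : PremodelStructure C}

/-- A functor which inverts the core acyclic maps inverts all equivalences. -/
theorem isIso_map_of_equivalences {D : Type*} [Category* D] (F : C ⥤ D)
    (hF : ∀ ⦃X Y : P.CF⦄ (f : X ⟶ Y), P.coreAcyclic f → IsIso (F.map f.hom))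
    {X Y : P.CF} {f : X ⟶ Y} (hf : P.equivalences f) : IsIso (F.map f.hom) := by
  let G := Localization.Construction.lift (W := P.coreAcyclic) (P.isFibrantOrCofibrant.ι ⋙ F) hF
  have e : P.coreAcyclic.Q ⋙ G = P.isFibrantOrCofibrant.ι ⋙ F :=
    Localization.Construction.fac _ _
  have : IsIso (P.coreAcyclic.Q.map f) := hf
  have h : IsIso ((P.coreAcyclic.Q ⋙ G).map f) :=
    inferInstanceAs (IsIso (G.map (P.coreAcyclic.Q.map f)))
  rw [e] at h
  exact h

instance : P.equivalences.HasTwoOutOfThreeProperty :=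
  inferInstanceAs ((MorphismProperty.isomorphisms _).inverseImage
    P.coreAcyclic.Q).HasTwoOutOfThreeProperty

theorem equivalences_of_coreAcyclic {X Y : P.CF} {f : X ⟶ Y} (hf : P.coreAcyclic f) :
    P.equivalences f := P.coreAcyclic.Q_inverts f hf

theorem IsTwoSided.leftEquivalences_of_equivalences (hP : P.IsTwoSided) {X Y : P.CF} {f : X ⟶ Y}
    (hf : P.equivalences f) : hP.leftEquivalences f.hom := fun Z hZ => by
  refine isIso_map_of_equivalences _ (fun X Y f hf => ?_) hf
  obtain ⟨h, h'⟩ | ⟨h, h'⟩ := hf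
  · exact hP.leftEquivalences_of_anoCof h (hP.bisaturated.left _ h') hZ
  · exact hP.anoFib_le_leftEquivalences _ (hP.bisaturated.right _ h') hZ

theorem IsTwoSided.rightEquivalences_of_equivalences (hP : P.IsTwoSided) {X Y : P.CF} {f : X ⟶ Y}
    (hf : P.equivalences f) : hP.rightEquivalences f.hom := fun Z hZ => by
  suffices IsIso ((hP.op.hoMapsFunctor hZ).unop.map f.hom) from
    (isIso_unop_iff ((hP.op.hoMapsFunctor hZ).map f.hom.op)).1 this
  refine isIso_map_of_equivalences _ (fun X Y f hf => ?_) hf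
  refine (isIso_unop_iff ((hP.op.hoMapsFunctor hZ).map f.hom.op)).2 ?_
  obtain ⟨h, h'⟩ | ⟨h, h'⟩ := hf
  · exact hP.op.anoFib_le_leftEquivalences f.hom.op (hP.bisaturated.left _ h') hZ
  · exact hP.op.leftEquivalences_of_anoCof (i := f.hom.op) ((P.isCofibrant_op_iff _).2 h)
      (hP.bisaturated.right _ h') hZ

/-- An anodyne fibration with cofibrant target need not be core, but it has a section which is
a homotopy inverse. -/
theorem IsTwoSided.equivalences_of_anoFib (hP : P.IsTwoSided) {A : C} (hA : P.IsCofibrant A)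
    {X : P.CF} (p : P.ofCofibrant A hA ⟶ X) (hp : P.anoFib p.hom) : P.equivalences p := by
  obtain hX | hX := X.property
  · exact equivalences_of_coreAcyclic (Or.inr ⟨hX, P.anoFib_le_acyclicFib _ hp⟩)
  · obtain ⟨t, ht⟩ := P.exists_lift_of_anoFib hX _ hp (𝟙 X.obj)
    let t' : X ⟶ P.ofCofibrant A hA := ObjectProperty.homMk t
    refine ⟨P.coreAcyclic.Q.map t', ?_, ?_⟩
    · rw [← Functor.map_comp, ← CategoryTheory.Functor.map_id]
      exact Ho_map_eq_of_anoFib hP.strongCylinders hA hA p.hom hp (p.hom ≫ t) (𝟙 _)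
        (by rw [Category.assoc, ht, Category.comp_id, Category.id_comp])
    · rw [← Functor.map_comp, ← CategoryTheory.Functor.map_id]
      exact congrArg _ (ObjectProperty.hom_ext _ ht)

theorem IsTwoSided.equivalences_of_anoCof (hP : P.IsTwoSided) {Y : C} (hY : P.IsFibrant Y)
    {X : P.CF} (i : X ⟶ P.ofFibrant Y hY) (hi : P.anoCof i.hom) : P.equivalences i := by
  obtain hX | hX := X.property
  · obtain ⟨t, ht⟩ := P.exists_extension_of_anoCof hX _ hi (𝟙 X.obj)
    let t' : P.ofFibrant Y hY ⟶ X := ObjectProperty.homMk t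
    refine ⟨P.coreAcyclic.Q.map t', ?_, ?_⟩
    · rw [← Functor.map_comp, ← CategoryTheory.Functor.map_id]
      exact congrArg _ (ObjectProperty.hom_ext _ ht)
    · rw [← Functor.map_comp, ← CategoryTheory.Functor.map_id]
      exact Ho_map_eq_of_anoCof hP.strongPathObjects hY hY i.hom hi (t ≫ i.hom) (𝟙 _)
        (by rw [reassoc_of% ht, Category.comp_id])
  · exact equivalences_of_coreAcyclic (Or.inl ⟨hX, P.anoCof_le_acyclicCof _ hi⟩)

theorem IsTwoSided.equivalences_homMk_iff_left (hP : P.IsTwoSided) {A B : C}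
    (hA : P.IsCofibrant A) (hB : P.IsCofibrant B) (f : A ⟶ B) :
    P.equivalences (ObjectProperty.homMk f : P.ofCofibrant A hA ⟶ P.ofCofibrant B hB) ↔
      hP.leftEquivalences f := by
  refine ⟨fun h => hP.leftEquivalences_of_equivalences h, fun h => ?_⟩
  obtain ⟨Z, i, p, rfl, hi, hp⟩ := P.exists_fac_cof_anoFib f
  have hZ := P.isCofibrant_of_cof hA i hi
  have hi' : P.anoCof i := hP.anoCof_of_leftEquivalences hA hi
    (hP.leftEquivalences.of_postcomp _ _ (hP.anoFib_le_leftEquivalences _ hp) h)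
  exact P.equivalences.comp_mem
    (ObjectProperty.homMk i : P.ofCofibrant A hA ⟶ P.ofCofibrant Z hZ)
    (ObjectProperty.homMk p : P.ofCofibrant Z hZ ⟶ P.ofCofibrant B hB)
    (equivalences_of_coreAcyclic (Or.inl ⟨hA, P.anoCof_le_acyclicCof _ hi'⟩))
    (hP.equivalences_of_anoFib _ _ hp)

theorem IsTwoSided.equivalences_homMk_iff_right (hP : P.IsTwoSided) {A B : C}
    (hA : P.IsFibrant A) (hB : P.IsFibrant B) (f : A ⟶ B) :
    P.equivalences (ObjectProperty.homMk f : P.ofFibrant A hA ⟶ P.ofFibrant B hB) ↔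
      hP.rightEquivalences f := by
  refine ⟨fun h => hP.rightEquivalences_of_equivalences h, fun h => ?_⟩
  have hR := hP.isRightSemiModel_rightEquivalences
  have := hR.twoOutOfThree
  obtain ⟨Z, i, p, rfl, hi, hp⟩ := P.exists_fac_anoCof_fib f
  have hZ := P.isFibrant_of_fib hB p hp
  have hp' : P.anoFib p := (hR.anoFib_iff hB hp).2
    (hP.rightEquivalences.of_precomp _ _ (hR.anoCof_le _ hi) h)
  exact P.equivalences.comp_mem
    (ObjectProperty.homMk i : P.ofFibrant A hA ⟶ P.ofFibrant Z hZ)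
    (ObjectProperty.homMk p : P.ofFibrant Z hZ ⟶ P.ofFibrant B hB)
    (hP.equivalences_of_anoCof _ _ hi)
    (equivalences_of_coreAcyclic (Or.inr ⟨hB, P.anoFib_le_acyclicFib _ hp'⟩))

theorem IsTwoSided.isIso_leftLocalization_map_iff (hP : P.IsTwoSided) {X Y : C} (f : X ⟶ Y) :
    IsIso ((leftLocalization hP.strongCylinders).map f) ↔ hP.leftEquivalences f := by
  refine (hP.equivalences_homMk_iff_left (P.cofRep_isCofibrant X) (P.cofRep_isCofibrant Y)
    (P.cofRepLift f)).trans ?_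
  have hX := hP.anoFib_le_leftEquivalences _ (P.cofRepMap_anoFib X)
  have hY := hP.anoFib_le_leftEquivalences _ (P.cofRepMap_anoFib Y)
  rw [← hP.leftEquivalences.postcomp_iff (W' := hP.leftEquivalences) _ _ hY, cofRepLift_comp,
    hP.leftEquivalences.precomp_iff (W' := hP.leftEquivalences) _ _ hX]

theorem IsTwoSided.isIso_rightLocalization_map_iff (hP : P.IsTwoSided) {X Y : C} (f : X ⟶ Y) :
    IsIso ((rightLocalization hP.strongPathObjects).map f) ↔ hP.rightEquivalences f := by
  refine (hP.equivalences_homMk_iff_right (P.fibRep_isFibrant X) (P.fibRep_isFibrant Y)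
    (P.fibRepExt f)).trans ?_
  have hR := hP.isRightSemiModel_rightEquivalences
  have := hR.twoOutOfThree
  have hX := hR.anoCof_le _ (P.fibRepMap_anoCof X)
  have hY := hR.anoCof_le _ (P.fibRepMap_anoCof Y)
  rw [← hP.rightEquivalences.precomp_iff (W' := hP.rightEquivalences) _ _ hX, comp_fibRepExt,
    hP.rightEquivalences.postcomp_iff (W' := hP.rightEquivalences) _ _ hY]

/-- Between objects that are fibrant or cofibrant, the left equivalences are the equivalences;
the same holds for the right equivalences, so the two classes agree there. -/
theorem IsTwoSided.equivalences_iff_left (hP : P.IsTwoSided) {X Y : P.CF} (f : X ⟶ Y) :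
    P.equivalences f ↔ hP.leftEquivalences f.hom := by
  refine ⟨hP.leftEquivalences_of_equivalences, fun h => ?_⟩
  let pX : P.ofCofibrant _ (P.cofRep_isCofibrant X.obj) ⟶ X :=
    ObjectProperty.homMk (P.cofRepMap X.obj)
  let pY : P.ofCofibrant _ (P.cofRep_isCofibrant Y.obj) ⟶ Y :=
    ObjectProperty.homMk (P.cofRepMap Y.obj)
  have hX : P.equivalences pX := hP.equivalences_of_anoFib _ _ (P.cofRepMap_anoFib _)
  have hY : P.equivalences pY := hP.equivalences_of_anoFib _ _ (P.cofRepMap_anoFib _)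
  let g : P.ofCofibrant _ (P.cofRep_isCofibrant X.obj) ⟶
      P.ofCofibrant _ (P.cofRep_isCofibrant Y.obj) := ObjectProperty.homMk (P.cofRepLift f.hom)
  have w : g ≫ pY = pX ≫ f := ObjectProperty.hom_ext _ (P.cofRepLift_comp f.hom)
  refine P.equivalences.of_precomp _ _ hX ?_
  rw [← w]
  exact P.equivalences.comp_mem _ _ ((hP.isIso_leftLocalization_map_iff f.hom).2 h) hY

theorem IsTwoSided.equivalences_iff_right (hP : P.IsTwoSided) {X Y : P.CF} (f : X ⟶ Y) :
    P.equivalences f ↔ hP.rightEquivalences f.hom := by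
  refine ⟨hP.rightEquivalences_of_equivalences, fun h => ?_⟩
  let iX : X ⟶ P.ofFibrant _ (P.fibRep_isFibrant X.obj) :=
    ObjectProperty.homMk (P.fibRepMap X.obj)
  let iY : Y ⟶ P.ofFibrant _ (P.fibRep_isFibrant Y.obj) :=
    ObjectProperty.homMk (P.fibRepMap Y.obj)
  have hX : P.equivalences iX := hP.equivalences_of_anoCof _ _ (P.fibRepMap_anoCof _)
  have hY : P.equivalences iY := hP.equivalences_of_anoCof _ _ (P.fibRepMap_anoCof _)
  let g : P.ofFibrant _ (P.fibRep_isFibrant X.obj) ⟶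
      P.ofFibrant _ (P.fibRep_isFibrant Y.obj) := ObjectProperty.homMk (P.fibRepExt f.hom)
  have w : iX ≫ g = f ≫ iY := ObjectProperty.hom_ext _ (P.comp_fibRepExt f.hom)
  refine P.equivalences.of_postcomp _ _ hY ?_
  rw [← w]
  exact P.equivalences.comp_mem _ _ hX ((hP.isIso_rightLocalization_map_iff f.hom).2 h)

/-! ### The characterization -/

/-- The equivalences satisfy the two-out-of-six property. -/
theorem equivalences_of_comp_of_comp {X Y Z T : P.CF} (f : X ⟶ Y) (g : Y ⟶ Z) (h : Z ⟶ T)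
    (hfg : IsIso (P.coreAcyclic.Q.map f ≫ P.coreAcyclic.Q.map g))
    (hgh : IsIso (P.coreAcyclic.Q.map g ≫ P.coreAcyclic.Q.map h)) :
    IsIso (P.coreAcyclic.Q.map f) ∧ IsIso (P.coreAcyclic.Q.map h) := by
  have : Mono (P.coreAcyclic.Q.map g) := mono_of_mono _ (P.coreAcyclic.Q.map h)
  have : IsSplitEpi (P.coreAcyclic.Q.map g) :=
    ⟨⟨inv (P.coreAcyclic.Q.map f ≫ P.coreAcyclic.Q.map g) ≫ P.coreAcyclic.Q.map f, by simp⟩⟩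
  have : IsIso (P.coreAcyclic.Q.map g) := isIso_of_mono_of_isSplitEpi _
  exact ⟨IsIso.of_isIso_comp_right _ (P.coreAcyclic.Q.map g),
    IsIso.of_isIso_comp_left (P.coreAcyclic.Q.map g) _⟩

/-- If every arrow has a fibrant replacement up to left equivalence, then the replacements are
compatible. The square attached to the fibrant replacement `X → Xᶠ` gives maps
`Xᶜ → Xᶠ → X' → Y'` in which both consecutive composites are equivalences, and the two-out-of-six
property applies. -/
theorem IsTwoSided.replacementsCompatible_of_fibrant (hP : P.IsTwoSided)
    (h : P.HasFibrantReplacements hP.leftEquivalences) : P.ReplacementsCompatible := fun X => by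
  refine ⟨_, _, P.cofRep_isCofibrant X, P.fibRep_isFibrant X, P.cofRepMap X, P.fibRepMap X,
    P.cofRepMap_anoFib X, P.fibRepMap_anoCof X, ?_⟩
  obtain ⟨X', Y', a, b, v', hX', hY', ha, hb, sq⟩ := h (P.fibRepMap X)
  obtain ⟨e, he⟩ := P.exists_extension_of_anoCof hX' _ (P.fibRepMap_anoCof X) a
  let e' : P.ofFibrant _ (P.fibRep_isFibrant X) ⟶ P.ofFibrant X' hX' := ObjectProperty.homMk e
  let v'' : P.ofFibrant X' hX' ⟶ P.ofFibrant Y' hY' := ObjectProperty.homMk v'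
  refine (equivalences_of_comp_of_comp _ e' v'' ?_ ?_).1
  · rw [← Functor.map_comp]
    refine (hP.equivalences_iff_left _).2 ?_
    change hP.leftEquivalences ((P.cofRepMap X ≫ P.fibRepMap X) ≫ e)
    rw [Category.assoc, he]
    exact hP.leftEquivalences.comp_mem _ _
      (hP.anoFib_le_leftEquivalences _ (P.cofRepMap_anoFib X)) ha
  · have : P.coreAcyclic.Q.map (e' ≫ v'') = P.coreAcyclic.Q.map (ObjectProperty.homMk b) :=
      Ho_map_eq_of_anoCof hP.strongPathObjects (P.fibRep_isFibrant X) hY' _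
        (P.fibRepMap_anoCof X) (e ≫ v') b (by rw [reassoc_of% he, sq.w])
    rw [← Functor.map_comp, this]
    exact (hP.equivalences_iff_left _).2 hb

theorem IsTwoSided.replacementsCompatible_of_cofibrant (hP : P.IsTwoSided)
    (h : P.HasCofibrantReplacements hP.rightEquivalences) : P.ReplacementsCompatible := fun X => by
  have hR := hP.isRightSemiModel_rightEquivalences
  have := hR.twoOutOfThree
  refine ⟨_, _, P.cofRep_isCofibrant X, P.fibRep_isFibrant X, P.cofRepMap X, P.fibRepMap X,
    P.cofRepMap_anoFib X, P.fibRepMap_anoCof X, ?_⟩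
  obtain ⟨X', Y', a, b, v', hX', hY', ha, hb, sq⟩ := h (P.cofRepMap X)
  obtain ⟨e, he⟩ := P.exists_lift_of_anoFib hY' _ (P.cofRepMap_anoFib X) b
  let e' : P.ofCofibrant Y' hY' ⟶ P.ofCofibrant _ (P.cofRep_isCofibrant X) :=
    ObjectProperty.homMk e
  let v'' : P.ofCofibrant X' hX' ⟶ P.ofCofibrant Y' hY' := ObjectProperty.homMk v'
  refine (equivalences_of_comp_of_comp v'' e' _ ?_ ?_).2
  · have : P.coreAcyclic.Q.map (v'' ≫ e') = P.coreAcyclic.Q.map (ObjectProperty.homMk a) :=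
      Ho_map_eq_of_anoFib hP.strongCylinders hX' (P.cofRep_isCofibrant X) _
        (P.cofRepMap_anoFib X) (v' ≫ e) a (by rw [Category.assoc, he, sq.w])
    rw [← Functor.map_comp, this]
    exact (hP.equivalences_iff_right _).2 ha
  · rw [← Functor.map_comp]
    refine (hP.equivalences_iff_right _).2 ?_
    change hP.rightEquivalences (e ≫ P.cofRepMap X ≫ P.fibRepMap X)
    rw [reassoc_of% he]
    exact hP.rightEquivalences.comp_mem _ _ hb (hR.anoCof_le _ (P.fibRepMap_anoCof X))

/-- The composites of the chosen cofibrant and fibrant replacement maps are strictly natural, so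
they form an isomorphism as soon as each of them is an equivalence. -/
theorem IsTwoSided.nonempty_iso_of_replacementsCompatible (hP : P.IsTwoSided)
    (h : P.ReplacementsCompatible) :
    Nonempty (leftLocalization hP.strongCylinders ≅ rightLocalization hP.strongPathObjects) := by
  let η (X : C) : P.ofCofibrant _ (P.cofRep_isCofibrant X) ⟶
    P.ofFibrant _ (P.fibRep_isFibrant X) := ObjectProperty.homMk (P.cofRepMap X ≫ P.fibRepMap X)
  have hη (X : C) : IsIso (P.coreAcyclic.Q.map (η X)) := by
    obtain ⟨Xc, Xf, hc, hf, p, i, hp, hi, hpi⟩ := h X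
    -- compare the given replacements with the chosen ones
    obtain ⟨s, hs⟩ := P.exists_lift_of_anoFib (P.cofRep_isCofibrant X) p hp (P.cofRepMap X)
    obtain ⟨t, ht⟩ := P.exists_extension_of_anoCof (P.fibRep_isFibrant X) i hi (P.fibRepMap X)
    let s' : P.ofCofibrant _ (P.cofRep_isCofibrant X) ⟶ P.ofCofibrant Xc hc :=
      ObjectProperty.homMk s
    let t' : P.ofFibrant Xf hf ⟶ P.ofFibrant _ (P.fibRep_isFibrant X) := ObjectProperty.homMk t
    have hs' : P.equivalences s' := (hP.equivalences_iff_left _).2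
      (hP.leftEquivalences.of_postcomp _ _ (hP.anoFib_le_leftEquivalences _ hp) (by
        change hP.leftEquivalences (s ≫ p)
        rw [hs]
        exact hP.anoFib_le_leftEquivalences _ (P.cofRepMap_anoFib X)))
    have hR := hP.isRightSemiModel_rightEquivalences
    have := hR.twoOutOfThree
    have ht' : P.equivalences t' := (hP.equivalences_iff_right _).2
      (hP.rightEquivalences.of_precomp _ _ (hR.anoCof_le _ hi) (by
        change hP.rightEquivalences (i ≫ t)
        rw [ht]
        exact hR.anoCof_le _ (P.fibRepMap_anoCof X)))
    have e : η X = s' ≫ ObjectProperty.homMk (p ≫ i) ≫ t' := by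
      apply ObjectProperty.hom_ext
      change P.cofRepMap X ≫ P.fibRepMap X = s ≫ (p ≫ i) ≫ t
      rw [Category.assoc, reassoc_of% hs, ht]
    rw [e]
    exact P.equivalences.comp_mem _ _ hs' (P.equivalences.comp_mem _ _ hpi ht')
  refine ⟨NatIso.ofComponents (fun X => @asIso _ _ _ _ (P.coreAcyclic.Q.map (η X)) (hη X))
    fun {X Y} f => ?_⟩
  change P.coreAcyclic.Q.map _ ≫ P.coreAcyclic.Q.map (η Y) =
    P.coreAcyclic.Q.map (η X) ≫ P.coreAcyclic.Q.map _
  rw [← Functor.map_comp, ← Functor.map_comp]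
  refine congrArg _ (ObjectProperty.hom_ext _ ?_)
  change P.cofRepLift f ≫ P.cofRepMap Y ≫ P.fibRepMap Y =
    (P.cofRepMap X ≫ P.fibRepMap X) ≫ P.fibRepExt f
  rw [Category.assoc, comp_fibRepExt, ← Category.assoc, cofRepLift_comp, Category.assoc]

theorem IsLeftSemiModel.isQuillenModel {W : MorphismProperty C} (hL : P.IsLeftSemiModel W)
    (hR : P.IsRightSemiModel W) : P.IsQuillenModel W := by
  let : HomotopicalAlgebra.CategoryWithCofibrations C := ⟨P.cof⟩
  let : HomotopicalAlgebra.CategoryWithFibrations C := ⟨P.fib⟩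
  let : HomotopicalAlgebra.CategoryWithWeakEquivalences C := ⟨W⟩
  have h₁ : (HomotopicalAlgebra.weakEquivalences C).HasTwoOutOfThreeProperty := hL.twoOutOfThree
  have h₂ : MorphismProperty.IsWeakFactorizationSystem (HomotopicalAlgebra.cofibrations C)
    (HomotopicalAlgebra.trivialFibrations C) := hL.wfs
  have h₃ : MorphismProperty.IsWeakFactorizationSystem (HomotopicalAlgebra.trivialCofibrations C)
    (HomotopicalAlgebra.fibrations C) := hR.wfs
  exact ⟨HomotopicalAlgebra.ModelCategory.mk' C, rfl, rfl, rfl⟩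

theorem IsQuillenModel.anoCof_le {W : MorphismProperty C} (h : P.IsQuillenModel W) :
    P.anoCof ≤ W := by
  obtain ⟨M, -, hf, hw⟩ := h
  have := MorphismProperty.llp_eq_of_wfs (HomotopicalAlgebra.trivialCofibrations C)
    (HomotopicalAlgebra.fibrations C)
  change M.categoryWithFibrations.fibrations.llp =
    _ ⊓ M.categoryWithWeakEquivalences.weakEquivalences at this
  rw [hf, hw, ← anoCof_eq_llp] at this
  rw [this]
  exact inf_le_right

theorem IsQuillenModel.anoFib_le {W : MorphismProperty C} (h : P.IsQuillenModel W) :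
    P.anoFib ≤ W := by
  obtain ⟨M, hc, -, hw⟩ := h
  have := MorphismProperty.rlp_eq_of_wfs (HomotopicalAlgebra.cofibrations C)
    (HomotopicalAlgebra.trivialFibrations C)
  change M.categoryWithCofibrations.cofibrations.rlp =
    _ ⊓ M.categoryWithWeakEquivalences.weakEquivalences at this
  rw [hc, hw, ← anoFib_eq_rlp] at this
  rw [this]
  exact inf_le_right

theorem replacementsCompatible_of_isFibrant_or_isCofibrant
    (h : ∀ X : C, P.IsFibrant X ∨ P.IsCofibrant X) : P.ReplacementsCompatible := fun X => by
  obtain hX | hX := h X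
  · refine ⟨_, _, P.cofRep_isCofibrant X, hX, P.cofRepMap X, 𝟙 X, P.cofRepMap_anoFib X,
      P.anoCof.id_mem X, equivalences_of_coreAcyclic (Or.inr ⟨hX, ?_⟩)⟩
    change P.acyclicFib (P.cofRepMap X ≫ 𝟙 X)
    rw [Category.comp_id]
    exact P.anoFib_le_acyclicFib _ (P.cofRepMap_anoFib X)
  · refine ⟨_, _, hX, P.fibRep_isFibrant X, 𝟙 X, P.fibRepMap X, P.anoFib.id_mem X,
      P.fibRepMap_anoCof X, equivalences_of_coreAcyclic (Or.inl ⟨hX, ?_⟩)⟩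
    change P.acyclicCof (𝟙 X ≫ P.fibRepMap X)
    rw [Category.id_comp]
    exact P.anoCof_le_acyclicCof _ (P.fibRepMap_anoCof X)

theorem IsTwoSided.tfae_quillenConditions (hP : P.IsTwoSided) :
    (quillenConditions hP hP.leftEquivalences hP.rightEquivalences).TFAE := by
  have hL := hP.isLeftSemiModel_leftEquivalences
  have hR := hP.isRightSemiModel_rightEquivalences
  unfold quillenConditions
  tfae_have 1 → 2 := fun h => hL.isQuillenModel (h ▸ hR)
  tfae_have 1 → 3 := fun h => IsLeftSemiModel.isQuillenModel (h ▸ hL) hR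
  tfae_have 2 → 4 := IsQuillenModel.anoCof_le
  tfae_have 3 → 5 := IsQuillenModel.anoFib_le
  tfae_have 4 → 6 := fun h X Y v => ⟨_, _, P.fibRepMap X, P.fibRepMap Y, P.fibRepExt v,
    P.fibRep_isFibrant X, P.fibRep_isFibrant Y, h _ (P.fibRepMap_anoCof X),
    h _ (P.fibRepMap_anoCof Y), ⟨P.comp_fibRepExt v⟩⟩
  tfae_have 5 → 7 := fun h X Y v => ⟨_, _, P.cofRepMap X, P.cofRepMap Y, P.cofRepLift v,
    P.cofRep_isCofibrant X, P.cofRep_isCofibrant Y, h _ (P.cofRepMap_anoFib X),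
    h _ (P.cofRepMap_anoFib Y), ⟨(P.cofRepLift_comp v).symm⟩⟩
  tfae_have 6 → 8 := hP.replacementsCompatible_of_fibrant
  tfae_have 7 → 8 := hP.replacementsCompatible_of_cofibrant
  tfae_have 8 → 9 := hP.nonempty_iso_of_replacementsCompatible
  tfae_have 9 → 1 := fun ⟨e⟩ => by
    ext X Y f
    rw [← hP.isIso_leftLocalization_map_iff, ← hP.isIso_rightLocalization_map_iff]
    exact (NatIso.isIso_map_iff e f).symm
  tfae_finish

end Ho

end PremodelStructure

theorem mainTheorem6 {C : Type u} [Category.{v} C] [HasLimits C] [HasColimits C]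
    (P : PremodelStructure C) (hP : P.IsTwoSided) :
    (∃! WL : MorphismProperty C, P.IsLeftSemiModel WL) ∧
    (∃! WR : MorphismProperty C, P.IsRightSemiModel WR) ∧
    ∀ WL WR : MorphismProperty C, P.IsLeftSemiModel WL → P.IsRightSemiModel WR →
      (PremodelStructure.quillenConditions hP WL WR).TFAE ∧
      ((∀ X : C, P.IsFibrant X ∨ P.IsCofibrant X) →
        ∀ c ∈ PremodelStructure.quillenConditions hP WL WR, c) := by
  have hL := hP.isLeftSemiModel_leftEquivalences
  have hR := hP.isRightSemiModel_rightEquivalences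
  refine ⟨⟨_, hL, fun W hW => le_antisymm (hW.le hL) (hL.le hW)⟩,
    ⟨_, hR, fun W hW => le_antisymm (hW.le hR) (hR.le hW)⟩, fun WL WR hWL hWR => ?_⟩
  obtain rfl : WL = hP.leftEquivalences := le_antisymm (hWL.le hL) (hL.le hWL)
  obtain rfl : WR = hP.rightEquivalences := le_antisymm (hWR.le hR) (hR.le hWR)
  have h := hP.tfae_quillenConditions
  refine ⟨h, fun hX c hc => (h P.ReplacementsCompatible ?_ c hc).1
    (PremodelStructure.replacementsCompatible_of_isFibrant_or_isCofibrant hX)⟩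
  simp [PremodelStructure.quillenConditions]
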